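/- All vector spaces are finite-dimensional and real. A *linear $2$-groupoid* is a simplicial vector space $V_\bullet$ (face maps $f_i$, degeneracy maps $\sigma_i$) whose horn maps $\lambda_{q,k}:V_q\to\Lambda_{q,k}V$, $x\mapsto(f_ix)_{i\ne k}$, are surjective for $q\ge 1$ and bijective for $q>2$. For a $2$-form $\omega$ on $V_2$ and $x\in V_0$ put, with $\omega$ evaluated at the point $\sigma_0\sigma_0x$, $$A_\omega(v,w)=\omega(\sigma_0\sigma_0v,w)\quad (v\in V_0,\ w\in V_2),\qquad B_\omega(\theta,\eta)=\omega(\sigma_1\theta,\sigma_0\eta)+\omega(\sigma_1\eta,\sigma_0\theta)\quad(\theta,\eta\in V_1).$$ Let $\delta=\sum_i(-1)^if_i^*$. A *constant symplectic $2$-groupoid* $(V_\bullet,\omega)$ is a linear $2$-groupoid with a constant $2$-form $\omega$ on $V_2$ that is closed, multiplicative ($\delta\omega=0$), normalized ($\sigma_i^*\omega=0$ for all $i$) and simplicially nondegenerate (at each $x \in V_0$ the pairings induced by $A_\omega$ on $V_0\times V_2/\sum_i\sigma_i(V_1)$ and by $B_\omega$ on $V_1/\sigma_0(V_0)$ are nondegenerate).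 Two such forms $\omega,\omega'$ on the same $V_\bullet$ are *equivalent* if $\omega'-\omega=\delta\alpha$ for some closed normalized (smooth, not necessarily constant) $2$-form $\alpha$ on $V_1$ with $A_{\delta\alpha}=B_{\delta\alpha}=0$. $(V_\bullet,\omega)$ and $(V'_\bullet,\omega')$ are in the same equivalence class if there is an isomorphism $\varphi:V_\bullet\to V'_\bullet$ of simplicial vector spaces with $\omega$ equivalent to $\varphi^*\omega'$. **Theorem 3.6.** There is a one-to-one correspondence between equivalence classes of constant symplectic $2$-groupoids and isomorphism classes of tuples $(W_1,W_0,\langle\cdot,\cdot\rangle,\partial)$, where - $W_1$ and $W_0$ are vector spaces, - $\langle\cdot,\cdot\rangle$ is a nondegenerate symmetric bilinear form on $W_1$, - $\partial:W_1\to W_0$ is a linear map such that the image of $\partial^*:W_0^*\to W_1^*\cong W_1$ is isotropic. The correspondence sends the class of $(V_\bullet,\omega)$ to the class of $W_1=\ker(f_0:V_1\to V_0)$, $W_0=V_0$, $\langle w,w'\rangle=B_\omega(w,w')$, $\partial w=-f_1w$. Moreover, let $(V_\bullet,\omega)$ be a constant symplectic $2$-groupoid. A constant $2$-form $\omega'$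 that also makes $V_\bullet$ a constant symplectic $2$-groupoid is equivalent to $\omega$ if and only if $A_{\omega'}=A_\omega$ and $B_{\omega'}=B_\omega$. For every $r\in\wedge^2W_1^*$ there is exactly one such $\omega'$ equivalent to $\omega$ for which $r$ is the skew-symmetric part of the bilinear form $(w,w')\mapsto\omega'(\sigma_1w,\ \sigma_0w'-\sigma_1w')$ on $W_1$. -/

import Mathlib

open CategoryTheory Simplicial

universe u

noncomputable section

namespace ConstSymp

/-! ### Differential 2-forms on real vector spaces

A (not necessarily constant) field of bilinear forms on `E` is a function `E → BilinForm ℝ E`;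
the tangent space at every point of `E` is `E` itself. -/

section Forms

variable {E F : Type*} [AddCommGroup E] [Module ℝ E] [AddCommGroup F] [Module ℝ F]

/-- Smoothness of a function on a (finite-dimensional) real vector space, tested on all linear
parametrisations by some `ℝⁿ`; for finite-dimensional `E` this is smoothness in one (equivalently
every) linear chart. -/
def SmoothFun (g : E → ℝ) : Prop :=
  ∀ (n : ℕ) (φ : (Fin n → ℝ) →ₗ[ℝ] E), ContDiff ℝ (⊤ : ℕ∞) (fun c => g (φ c))

/-- Smooth differential 2-forms. -/
structure IsTwoForm (α : E → LinearMap.BilinForm ℝ E) : Prop where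
  alt : ∀ x, (α x).IsAlt
  smooth : ∀ v w, SmoothFun (fun x => α x v w)

/-- `dα = 0`: the exterior derivative evaluated on the constant vector fields `u`, `v`, `w`. -/
def ClosedForm (α : E → LinearMap.BilinForm ℝ E) : Prop :=
  ∀ x u v w : E,
    lineDeriv ℝ (fun y => α y v w) x u - lineDeriv ℝ (fun y => α y u w) x v
      + lineDeriv ℝ (fun y => α y u v) x w = 0

/-- Pullback `f^* α` along a linear map `f` (which is its own differential). -/
def pullback (f : E →ₗ[ℝ] F) (α : F → LinearMap.BilinForm ℝ F) : E → LinearMap.BilinForm ℝ E :=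
  fun x => (α (f x)).comp f f

/-- The constant field with value `ω`. -/
def constForm (ω : LinearMap.BilinForm ℝ E) : E → LinearMap.BilinForm ℝ E := fun _ => ω

end Forms

/-! ### Linear 2-groupoids -/

/-- Simplicial real vector spaces. -/
abbrev SVect : Type (u + 1) := SimplicialObject (ModuleCat.{u} ℝ)

/-- The face map `f_i : V_{n+1} → V_n`. -/
def face (V : SVect.{u}) {n : ℕ} (i : Fin (n + 2)) : V _⦋n + 1⦌ →ₗ[ℝ] V _⦋n⦌ := (V.δ i).hom

/-- The degeneracy map `σ_i : V_n → V_{n+1}`. -/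
def degen (V : SVect.{u}) {n : ℕ} (i : Fin (n + 1)) : V _⦋n⦌ →ₗ[ℝ] V _⦋n + 1⦌ := (V.σ i).hom

/-- The space of `(n+1, k)`-horns: families `(x_i)_{i ≠ k}` in `V_n` with
`f_i x_j = f_{j-1} x_i` for `i < j` (here `i` is `a.castSucc` and `j` is `b.succ` with `a ≤ b`).
There is no compatibility condition for `(1, k)`-horns. -/
def hornSpace (V : SVect.{u}) (n : ℕ) (k : Fin (n + 2)) :
    Set ({i : Fin (n + 2) // i ≠ k} → V _⦋n⦌) :=
  match n, k with
  | 0, _ => Set.univ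
  | _ + 1, k => {x | ∀ a b, a ≤ b → ∀ (ha : a.castSucc ≠ k) (hb : b.succ ≠ k),
      face V a (x ⟨b.succ, hb⟩) = face V b (x ⟨a.castSucc, ha⟩)}

/-- The horn map `λ_{n+1,k}`, which omits the `k`-th face. -/
def hornMap (V : SVect.{u}) (n : ℕ) (k : Fin (n + 2)) (x : V _⦋n + 1⦌) :
    {i : Fin (n + 2) // i ≠ k} → V _⦋n⦌ :=
  fun i => face V i.1 x

/-- Linear 2-groupoids: Lie 2-groupoids whose spaces are (finite-dimensional) vector spaces and
whose structure maps are linear. For linear maps, surjective submersions are the surjective maps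
and diffeomorphisms are the bijective maps; face maps are automatically surjective and
degeneracy maps automatically injective, by the simplicial identities. -/
structure IsLinearTwoGroupoid (V : SVect.{u}) : Prop where
  finite : ∀ n, FiniteDimensional ℝ (V _⦋n⦌)
  horn_surj : ∀ (n : ℕ) (k : Fin (n + 2)),
    Set.SurjOn (hornMap V n k) Set.univ (hornSpace V n k)
  horn_bij : ∀ (n : ℕ) (k : Fin (n + 2)), 2 < n + 1 →
    Set.BijOn (hornMap V n k) Set.univ (hornSpace V n k)

/-! ### Forms on simplicial vector spaces -/

/-- The simplicial coboundary `δα = ∑ (-1)^i f_i^* α`. -/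
def cobdry (V : SVect.{u}) {n : ℕ} (α : V _⦋n⦌ → LinearMap.BilinForm ℝ (V _⦋n⦌)) :
    V _⦋n + 1⦌ → LinearMap.BilinForm ℝ (V _⦋n + 1⦌) :=
  fun x => ∑ i : Fin (n + 2), (-1 : ℝ) ^ (i : ℕ) • pullback (face V i) α x

/-- Multiplicative: `δα = 0`. -/
def Multiplicative (V : SVect.{u}) {n : ℕ} (α : V _⦋n⦌ → LinearMap.BilinForm ℝ (V _⦋n⦌)) : Prop :=
  ∀ x, cobdry V α x = 0

/-- Normalized: all pullbacks by degeneracy maps vanish. -/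
def Normalized (V : SVect.{u}) {n : ℕ}
    (α : V _⦋n + 1⦌ → LinearMap.BilinForm ℝ (V _⦋n + 1⦌)) : Prop :=
  ∀ (i : Fin (n + 1)) x, pullback (degen V i) α x = 0

/-- The sum of the degenerate subspaces of `V_{n+1}`; the quotient by it is the term of the tangent
complex in degree `n + 1`. -/
def degenerate (V : SVect.{u}) (n : ℕ) : Submodule ℝ (V _⦋n + 1⦌) :=
  ⨆ i : Fin (n + 1), LinearMap.range (degen V i)

/-- The iterated degeneracy `σ² = σ_0 σ_0 : V_0 → V_2`. -/
def unit2 (V : SVect.{u}) : V _⦋0⦌ →ₗ[ℝ] V _⦋2⦌ :=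
  (degen V (n := 1) 0).comp (degen V (n := 0) 0)

/-- `Ã_ω(v, w) = ω(σ² v, w)` at the point `x ∈ V_0`. -/
def pairA (V : SVect.{u}) (ω : V _⦋2⦌ → LinearMap.BilinForm ℝ (V _⦋2⦌))
    (x v : V _⦋0⦌) (w : V _⦋2⦌) : ℝ :=
  ω (unit2 V x) (unit2 V v) w

/-- `B̃_ω(θ, η) = ω(σ_1 θ, σ_0 η) + ω(σ_1 η, σ_0 θ)` at the point `x ∈ V_0`. -/
def pairB (V : SVect.{u}) (ω : V _⦋2⦌ → LinearMap.BilinForm ℝ (V _⦋2⦌))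
    (x : V _⦋0⦌) (θ η : V _⦋1⦌) : ℝ :=
  ω (unit2 V x) (degen V (n := 1) 1 θ) (degen V (n := 1) 0 η)
    + ω (unit2 V x) (degen V (n := 1) 1 η) (degen V (n := 1) 0 θ)

/-- Simplicial nondegeneracy of a normalized form: at every `x ∈ V_0`, the pairing induced by `Ã_ω`
between `V_0` and `V_2 / degenerate` and the symmetric form induced by `B̃_ω` on
`V_1 / degenerate` are nondegenerate. -/
structure SimpliciallyNondegenerate (V : SVect.{u})
    (ω : V _⦋2⦌ → LinearMap.BilinForm ℝ (V _⦋2⦌)) : Prop where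
  left_A : ∀ x v, (∀ w, pairA V ω x v w = 0) → v = 0
  right_A : ∀ x w, (∀ v, pairA V ω x v w = 0) → w ∈ degenerate V 1
  nondeg_B : ∀ x θ, (∀ η, pairB V ω x θ η = 0) → θ ∈ degenerate V 0

/-- The 2-forms that make a linear 2-groupoid a symplectic 2-groupoid. -/
structure IsSymplecticForm (V : SVect.{u})
    (ω : V _⦋2⦌ → LinearMap.BilinForm ℝ (V _⦋2⦌)) : Prop where
  form : IsTwoForm ω
  closed : ClosedForm ω
  mult : Multiplicative V ω
  normalized : Normalized V (n := 1) ω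
  nondeg : SimpliciallyNondegenerate V ω

/-- Equivalence of 2-forms on `V_2`: `ω' - ω = δα` for a closed normalized 2-form `α` on `V_1`
(not assumed constant) with `A_{δα} = 0` and `B_{δα} = 0`. -/
def FormEquiv (V : SVect.{u}) (ω ω' : V _⦋2⦌ → LinearMap.BilinForm ℝ (V _⦋2⦌)) : Prop :=
  ∃ α : V _⦋1⦌ → LinearMap.BilinForm ℝ (V _⦋1⦌),
    IsTwoForm α ∧ ClosedForm α ∧ Normalized V (n := 0) α ∧
    (∀ x, ω' x - ω x = cobdry V α x) ∧
    (∀ x v w, pairA V (cobdry V α) x v w = 0) ∧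
    (∀ x θ η, pairB V (cobdry V α) x θ η = 0)

/-! ### Constant symplectic 2-groupoids -/

/-- A constant symplectic 2-groupoid. -/
structure ConstSympGpd : Type (u + 1) where
  V : SVect.{u}
  isLinear : IsLinearTwoGroupoid V
  ω : LinearMap.BilinForm ℝ (V _⦋2⦌)
  isSymplectic : IsSymplecticForm V (constForm ω)

/-- The level-`n` component of a simplicial linear map. -/
def level {V V' : SVect.{u}} (φ : V ⟶ V') (n : ℕ) : V _⦋n⦌ →ₗ[ℝ] V' _⦋n⦌ :=
  (φ.app (Opposite.op ⦋n⦌)).hom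

/-- Two constant symplectic 2-groupoids define the same class if, after an isomorphism of the
underlying linear 2-groupoids, their 2-forms are equivalent. -/
def ConstSympGpd.Equivalent (G G' : ConstSympGpd.{u}) : Prop :=
  ∃ φ : G.V ≅ G'.V,
    FormEquiv G.V (constForm G.ω) (pullback (level φ.hom 2) (constForm G'.ω))

/-! ### The linear algebra data -/

/-- The transpose `∂^* : W₀^* → W₁^* ≅ W₁` of `∂ : W₁ → W₀`, where `W₁` is identified with its dual
by means of a nondegenerate bilinear form. -/
def transposeVia {W₁ W₀ : Type*} [AddCommGroup W₁] [Module ℝ W₁] [FiniteDimensional ℝ W₁]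
    [AddCommGroup W₀] [Module ℝ W₀] (b : LinearMap.BilinForm ℝ W₁) (hb : b.Nondegenerate)
    (bd : W₁ →ₗ[ℝ] W₀) : Module.Dual ℝ W₀ →ₗ[ℝ] W₁ :=
  (b.toDual hb).symm.toLinearMap.comp bd.dualMap

/-- Tuples `(W₁, W₀, ⟨·,·⟩, ∂)`: finite-dimensional real vector spaces, a nondegenerate symmetric
bilinear form on `W₁`, and a linear map `∂ : W₁ → W₀` such that the image of `∂^*` is isotropic. -/
structure LinData : Type (u + 1) where
  W₁ : Type u
  W₀ : Type u
  [addCommGroup₁ : AddCommGroup W₁]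
  [module₁ : Module ℝ W₁]
  [finite₁ : FiniteDimensional ℝ W₁]
  [addCommGroup₀ : AddCommGroup W₀]
  [module₀ : Module ℝ W₀]
  [finite₀ : FiniteDimensional ℝ W₀]
  pairing : LinearMap.BilinForm ℝ W₁
  symm : pairing.IsSymm
  nondeg : pairing.Nondegenerate
  bd : W₁ →ₗ[ℝ] W₀
  isotropic : ∀ x ∈ LinearMap.range (transposeVia pairing nondeg bd),
    ∀ y ∈ LinearMap.range (transposeVia pairing nondeg bd), pairing x y = 0

attribute [instance] LinData.addCommGroup₁ LinData.module₁ LinData.finite₁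
  LinData.addCommGroup₀ LinData.module₀ LinData.finite₀

/-- Isomorphism of tuples. -/
def LinData.Isomorphic (T T' : LinData.{u}) : Prop :=
  ∃ (g₁ : T.W₁ ≃ₗ[ℝ] T'.W₁) (g₀ : T.W₀ ≃ₗ[ℝ] T'.W₀),
    (∀ w w', T'.pairing (g₁ w) (g₁ w') = T.pairing w w') ∧
    (∀ w, T'.bd (g₁ w) = g₀ (T.bd w))

/-- `W₁ = ker f_0 ⊆ V_1`. -/
abbrev kerFace (V : SVect.{u}) : Submodule ℝ (V _⦋1⦌) := LinearMap.ker (face V (n := 0) 0)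

/-- The tuple of a constant symplectic 2-groupoid `(V, ω)` is, up to isomorphism, `W₁ = ker f_0`,
`W₀ = V_0`, `⟨w, w'⟩ = B_ω(w, w')` and `∂ w = - f_1 w`. -/
def HasData (G : ConstSympGpd.{u}) (T : LinData.{u}) : Prop :=
  ∃ (e₁ : T.W₁ ≃ₗ[ℝ] kerFace G.V) (e₀ : T.W₀ ≃ₗ[ℝ] G.V _⦋0⦌),
    (∀ w w', T.pairing w w' =
      pairB G.V (constForm G.ω) 0 (e₁ w : G.V _⦋1⦌) (e₁ w' : G.V _⦋1⦌)) ∧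
    (∀ w, e₀ (T.bd w) = - face G.V (n := 0) 1 (e₁ w : G.V _⦋1⦌))

/-- The component `C₃₂(w, w') = ω((0,0,w,0), (0,w',0,0))` on `W₁ = ker f_0` of a constant 2-form
in the decomposition `V_2 = W₂ ⊕ W₁ ⊕ W₁ ⊕ W₀`, where `(0,0,w,0) = σ_1 w` and
`(0,w',0,0) = σ_0 w' - σ_1 w'`. -/
def C32 (V : SVect.{u}) (ω : LinearMap.BilinForm ℝ (V _⦋2⦌)) (w w' : kerFace V) : ℝ :=
  ω (degen V (n := 1) 1 (w : V _⦋1⦌))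
    (degen V (n := 1) 0 (w' : V _⦋1⦌) - degen V (n := 1) 1 (w' : V _⦋1⦌))

/-- The skew-symmetric part `r` of `C₃₂`. -/
def skewPart (V : SVect.{u}) (ω : LinearMap.BilinForm ℝ (V _⦋2⦌)) (w w' : kerFace V) : ℝ :=
  (C32 V ω w w' - C32 V ω w' w) / 2

/-! ### The two relations are equivalence relations -/

section Lemmas

variable {E F : Type*} [AddCommGroup E] [Module ℝ E] [AddCommGroup F] [Module ℝ F]

lemma SmoothFun.lineDifferentiableAt {g : E → ℝ} (hg : SmoothFun g) (x v : E) :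
    LineDifferentiableAt ℝ g x v := by
  let φ : (Fin 2 → ℝ) →ₗ[ℝ] E :=
    (LinearMap.proj 0 : (Fin 2 → ℝ) →ₗ[ℝ] ℝ).smulRight x
      + (LinearMap.proj 1 : (Fin 2 → ℝ) →ₗ[ℝ] ℝ).smulRight v
  have h := (hg 2 φ).differentiable (by simp)
  have h2 : Differentiable ℝ (fun t : ℝ => (![1, t] : Fin 2 → ℝ)) := by
    rw [differentiable_pi]
    intro i
    fin_cases i
    · simp
    · simp
  have h3 := (h.comp h2) 0
  simpa [LineDifferentiableAt, φ, Function.comp_def] using h3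

lemma IsTwoForm.pullback {α : F → LinearMap.BilinForm ℝ F} (h : IsTwoForm α) (f : E →ₗ[ℝ] F) :
    IsTwoForm (pullback f α) where
  alt x v := h.alt (f x) (f v)
  smooth v w n φ := h.smooth (f v) (f w) n (f.comp φ)

lemma ClosedForm.pullback {α : F → LinearMap.BilinForm ℝ F} (h : ClosedForm α) (f : E →ₗ[ℝ] F) :
    ClosedForm (pullback f α) := by
  intro x u v w
  have := h (f x) (f u) (f v) (f w)
  simpa [lineDeriv, ConstSymp.pullback, LinearMap.BilinForm.comp_apply] using this

lemma IsTwoForm.add {α β : E → LinearMap.BilinForm ℝ E} (h : IsTwoForm α) (h' : IsTwoForm β) :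
    IsTwoForm (fun x => α x + β x) where
  alt x v := by simp [h.alt x v, h'.alt x v]
  smooth v w n φ := (h.smooth v w n φ).add (h'.smooth v w n φ)

lemma IsTwoForm.neg {α : E → LinearMap.BilinForm ℝ E} (h : IsTwoForm α) :
    IsTwoForm (fun x => - α x) where
  alt x v := by simp [h.alt x v]
  smooth v w n φ := (h.smooth v w n φ).neg

lemma ClosedForm.neg {α : E → LinearMap.BilinForm ℝ E} (h : ClosedForm α) :
    ClosedForm (fun x => - α x) := by
  intro x u v w
  have := h x u v w
  simp only [lineDeriv, LinearMap.neg_apply, deriv.fun_neg] at this ⊢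
  linarith

lemma ClosedForm.add {α β : E → LinearMap.BilinForm ℝ E} (hα : IsTwoForm α) (hβ : IsTwoForm β)
    (h : ClosedForm α) (h' : ClosedForm β) : ClosedForm (fun x => α x + β x) := by
  intro x u v w
  have e : ∀ a b c : E, lineDeriv ℝ (fun y => (α y + β y) a b) x c
      = lineDeriv ℝ (fun y => α y a b) x c + lineDeriv ℝ (fun y => β y a b) x c := fun a b c =>
    deriv_fun_add ((hα.smooth a b).lineDifferentiableAt x c)
      ((hβ.smooth a b).lineDifferentiableAt x c)
  have h1 := h x u v w
  have h2 := h' x u v w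
  simp only [e]
  linarith

variable {V V' V'' : SVect.{u}}

lemma level_face (φ : V ⟶ V') {n : ℕ} (i : Fin (n + 2)) (x : V _⦋n + 1⦌) :
    face V' i (level φ (n + 1) x) = level φ n (face V i x) :=
  (LinearMap.congr_fun (congrArg ModuleCat.Hom.hom (SimplicialObject.δ_naturality φ i)) x).symm

lemma level_degen (φ : V ⟶ V') {n : ℕ} (i : Fin (n + 1)) (x : V _⦋n⦌) :
    degen V' i (level φ n x) = level φ (n + 1) (degen V i x) :=
  (LinearMap.congr_fun (congrArg ModuleCat.Hom.hom (SimplicialObject.σ_naturality φ i)) x).symm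

lemma cobdry_pullback (φ : V ⟶ V') {n : ℕ} (α : V' _⦋n⦌ → LinearMap.BilinForm ℝ (V' _⦋n⦌))
    (x : V _⦋n + 1⦌) :
    cobdry V (pullback (level φ n) α) x = pullback (level φ (n + 1)) (cobdry V' α) x := by
  ext v w
  simp [cobdry, pullback, LinearMap.BilinForm.comp_apply, level_face, LinearMap.sum_apply]

lemma cobdry_add {n : ℕ} (α β : V _⦋n⦌ → LinearMap.BilinForm ℝ (V _⦋n⦌)) (x : V _⦋n + 1⦌) :
    cobdry V (fun y => α y + β y) x = cobdry V α x + cobdry V β x := by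
  ext v w
  simp [cobdry, pullback, LinearMap.BilinForm.comp_apply, LinearMap.sum_apply, mul_add,
    Finset.sum_add_distrib]

lemma cobdry_neg {n : ℕ} (α : V _⦋n⦌ → LinearMap.BilinForm ℝ (V _⦋n⦌)) (x : V _⦋n + 1⦌) :
    cobdry V (fun y => - α y) x = - cobdry V α x := by
  ext v w
  simp [cobdry, pullback, LinearMap.BilinForm.comp_apply, LinearMap.sum_apply]

lemma level_unit2 (φ : V ⟶ V') (x : V _⦋0⦌) :
    unit2 V' (level φ 0 x) = level φ 2 (unit2 V x) := by
  simp [unit2, level_degen]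

lemma FormEquiv.refl (ω : V _⦋2⦌ → LinearMap.BilinForm ℝ (V _⦋2⦌)) : FormEquiv V ω ω := by
  refine ⟨fun _ => 0, ⟨fun x v => by simp, fun v w n φ => by simpa using contDiff_const⟩, ?_, ?_,
    ?_, ?_, ?_⟩
  · intro x u v w
    simp [lineDeriv]
  · intro i x
    ext v w
    simp [pullback, LinearMap.BilinForm.comp_apply]
  all_goals intros
  · ext v w
    simp [cobdry, pullback, LinearMap.BilinForm.comp_apply, LinearMap.sum_apply]
  · simp [pairA, cobdry, pullback, LinearMap.BilinForm.comp_apply, LinearMap.sum_apply]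
  · simp [pairB, cobdry, pullback, LinearMap.BilinForm.comp_apply, LinearMap.sum_apply]

lemma FormEquiv.symm {ω ω' : V _⦋2⦌ → LinearMap.BilinForm ℝ (V _⦋2⦌)} (h : FormEquiv V ω ω') :
    FormEquiv V ω' ω := by
  obtain ⟨α, h1, h2, h3, h4, h5, h6⟩ := h
  refine ⟨fun x => - α x, h1.neg, h2.neg, ?_, ?_, ?_, ?_⟩
  · intro i x
    have := h3 i x
    ext v w
    have := LinearMap.congr_fun (LinearMap.congr_fun this v) w
    simpa [pullback, LinearMap.BilinForm.comp_apply] using this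
  · intro x
    rw [cobdry_neg, ← h4 x]
    abel
  · intro x v w
    simpa [pairA, cobdry_neg] using h5 x v w
  · intro x v w
    have := h6 x v w
    simp only [pairB, cobdry_neg, LinearMap.neg_apply] at this ⊢
    linarith

lemma FormEquiv.trans {ω ω' ω'' : V _⦋2⦌ → LinearMap.BilinForm ℝ (V _⦋2⦌)}
    (h : FormEquiv V ω ω') (h' : FormEquiv V ω' ω'') : FormEquiv V ω ω'' := by
  obtain ⟨α, h1, h2, h3, h4, h5, h6⟩ := h
  obtain ⟨β, k1, k2, k3, k4, k5, k6⟩ := h'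
  refine ⟨fun x => α x + β x, h1.add k1, h2.add h1 k1 k2, ?_, ?_, ?_, ?_⟩
  · intro i x
    ext v w
    have e1 := LinearMap.congr_fun (LinearMap.congr_fun (h3 i x) v) w
    have e2 := LinearMap.congr_fun (LinearMap.congr_fun (k3 i x) v) w
    simp only [pullback, LinearMap.BilinForm.comp_apply, LinearMap.add_apply,
      LinearMap.zero_apply] at e1 e2 ⊢
    linarith
  · intro x
    rw [cobdry_add, ← h4 x, ← k4 x]
    abel
  · intro x v w
    have e1 := h5 x v w
    have e2 := k5 x v w
    simp only [pairA, cobdry_add, LinearMap.add_apply] at e1 e2 ⊢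
    linarith
  · intro x v w
    have e1 := h6 x v w
    have e2 := k6 x v w
    simp only [pairB, cobdry_add, LinearMap.add_apply] at e1 e2 ⊢
    linarith

lemma FormEquiv.pullback {ω ω' : V' _⦋2⦌ → LinearMap.BilinForm ℝ (V' _⦋2⦌)}
    (h : FormEquiv V' ω ω') (φ : V ⟶ V') :
    FormEquiv V (pullback (level φ 2) ω) (pullback (level φ 2) ω') := by
  obtain ⟨α, h1, h2, h3, h4, h5, h6⟩ := h
  refine ⟨ConstSymp.pullback (level φ 1) α, h1.pullback _, h2.pullback _, ?_, ?_, ?_, ?_⟩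
  · intro i x
    ext v w
    have e1 := LinearMap.congr_fun (LinearMap.congr_fun (h3 i (level φ 0 x)) (level φ 0 v))
      (level φ 0 w)
    simpa [ConstSymp.pullback, LinearMap.BilinForm.comp_apply, level_degen] using e1
  · intro x
    rw [cobdry_pullback]
    ext v w
    have e1 := LinearMap.congr_fun (LinearMap.congr_fun (h4 (level φ 2 x)) (level φ 2 v))
      (level φ 2 w)
    simpa [ConstSymp.pullback, LinearMap.BilinForm.comp_apply] using e1
  · intro x v w
    have e1 := h5 (level φ 0 x) (level φ 0 v) (level φ 2 w)
    simpa [pairA, cobdry_pullback, ConstSymp.pullback, LinearMap.BilinForm.comp_apply,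
      level_unit2] using e1
  · intro x v w
    have e1 := h6 (level φ 0 x) (level φ 1 v) (level φ 1 w)
    simpa [pairB, cobdry_pullback, ConstSymp.pullback, LinearMap.BilinForm.comp_apply,
      level_unit2, level_degen] using e1

lemma level_id (n : ℕ) (x : V _⦋n⦌) : level (𝟙 V) n x = x := rfl

lemma level_comp (φ : V ⟶ V') (ψ : V' ⟶ V'') (n : ℕ) (x : V _⦋n⦌) :
    level (φ ≫ ψ) n x = level ψ n (level φ n x) := rfl

end Lemmas

/-- Equivalence classes of constant symplectic 2-groupoids are the classes for this relation. -/
instance ConstSympGpd.setoid : Setoid ConstSympGpd.{u} where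
  r := ConstSympGpd.Equivalent
  iseqv :=
    { refl := fun G => ⟨Iso.refl _, FormEquiv.refl _⟩
      symm := by
        rintro G G' ⟨φ, h⟩
        refine ⟨φ.symm, ?_⟩
        have h2 := (h.pullback φ.inv).symm
        have e : pullback (level φ.inv 2) (pullback (level φ.hom 2) (constForm G'.ω))
            = constForm G'.ω := by
          funext x
          ext v w
          simp [pullback, constForm, LinearMap.BilinForm.comp_apply, ← level_comp, level_id]
        rw [e] at h2
        exact h2
      trans := by
        rintro G G' G'' ⟨φ, h⟩ ⟨ψ, h'⟩
        exact ⟨φ ≪≫ ψ, h.trans (h'.pullback φ.hom)⟩ }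

/-- Isomorphism classes of tuples. -/
instance LinData.setoid : Setoid LinData.{u} where
  r := LinData.Isomorphic
  iseqv :=
    { refl := fun T => ⟨LinearEquiv.refl _ _, LinearEquiv.refl _ _, by simp, by simp⟩
      symm := by
        rintro T T' ⟨g₁, g₀, h, h'⟩
        refine ⟨g₁.symm, g₀.symm, fun w w' => ?_, fun w => ?_⟩
        · rw [← h]; simp
        · rw [LinearEquiv.eq_symm_apply, ← h']; simp
      trans := by
        rintro T T' T'' ⟨g₁, g₀, h, h'⟩ ⟨k₁, k₀, k, k'⟩
        exact ⟨g₁.trans k₁, g₀.trans k₀, fun w w' => by simp [k, h], fun w => by simp [k', h']⟩ }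

end ConstSymp

end

/-! The theorem combines Dold–Kan with the fact that a constant multiplicative normalized form is
determined up to equivalence by `A` and `B`.

Simplicial side. Let `normSub V n` be the common kernel of `f_1, …, f_n`, a complex with
differential `f_0`. Simplicial vector spaces are Kan (`surjOn_hornMap`), so in finite dimension a
linear 2-groupoid is exactly one whose normalized complex vanishes in degrees at least 3
(`IsLinearTwoGroupoid.normSub_eq_bot`, `isLinearTwoGroupoid_of_normSub`). By Dold–Kan, V is
therefore a three-term complex.

Form side. Multiplicativity on degenerate 3-simplices gives `pairB_differential`: `A` and `B` make
the two differentials of the complex adjoint. Nondegeneracy then identifies degree 2 with the dual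
of `V_0`, and its differential with `∂^*`, so the complex is `W₀^* → W₁ → W₀`. That it is a complex,
`∂∂^* = 0`, is precisely the isotropy of the image of `∂^*`.

If `A` and `B` vanish, the same identities write ω as the coboundary of a constant form on `V_1`
(`eq_coboundary`). Hence equivalence of constant forms means equality of `A` and `B`
(`formEquiv_iff`). An isomorphism of tuples extends to one of normalized complexes, hence of
simplicial spaces, and matches `A` and `B`, which gives injectivity (`equivalent_of_data`). For
surjectivity, Dold–Kan realizes the complex and `cocycleOf` is an explicit form with the prescribed
`A` and `B` (`exists_hasData`).

The remaining freedom is the coboundary of an alternating form on `V_1` killing degenerate vectors,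
that is, an alternating form on `ker f_0`. It shifts the skew part by an arbitrary amount and
nothing else (`existsUnique_skewPart`). -/

noncomputable section

namespace ConstSymp

/-! ### Simplicial identities on elements -/

section Identities

variable (V : SVect.{u})

lemma face_face {n : ℕ} {a b : Fin (n + 2)} (h : a ≤ b) (x : V _⦋n + 2⦌) :
    face V a (face V b.succ x) = face V b (face V a.castSucc x) :=
  LinearMap.congr_fun (congrArg ModuleCat.Hom.hom (V.δ_comp_δ h)) x

lemma face_degen_self {n : ℕ} (i : Fin (n + 1)) (x : V _⦋n⦌) :
    face V i.castSucc (degen V i x) = x :=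
  LinearMap.congr_fun (congrArg ModuleCat.Hom.hom (V.δ_comp_σ_self (i := i))) x

lemma face_degen_succ {n : ℕ} (i : Fin (n + 1)) (x : V _⦋n⦌) :
    face V i.succ (degen V i x) = x :=
  LinearMap.congr_fun (congrArg ModuleCat.Hom.hom (V.δ_comp_σ_succ (i := i))) x

lemma face_degen_of_le {n : ℕ} {i : Fin (n + 2)} {j : Fin (n + 1)} (h : i ≤ j.castSucc)
    (x : V _⦋n + 1⦌) :
    face V i.castSucc (degen V j.succ x) = degen V j (face V i x) :=
  LinearMap.congr_fun (congrArg ModuleCat.Hom.hom (V.δ_comp_σ_of_le h)) x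

lemma face_degen_of_gt {n : ℕ} {i : Fin (n + 2)} {j : Fin (n + 1)} (h : j.castSucc < i)
    (x : V _⦋n + 1⦌) :
    face V i.succ (degen V j.castSucc x) = degen V j (face V i x) :=
  LinearMap.congr_fun (congrArg ModuleCat.Hom.hom (V.δ_comp_σ_of_gt h)) x

lemma degen_degen {n : ℕ} {i j : Fin (n + 1)} (h : i ≤ j) (x : V _⦋n⦌) :
    degen V i.castSucc (degen V j x) = degen V j.succ (degen V i x) :=
  LinearMap.congr_fun (congrArg ModuleCat.Hom.hom (V.σ_comp_σ h)) x

/-! In levels at most three. -/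

lemma face0_0_degen0 (x : V _⦋0⦌) : face V (n := 0) 0 (degen V (n := 0) 0 x) = x :=
  face_degen_self V (n := 0) 0 x
lemma face0_1_degen0 (x : V _⦋0⦌) : face V (n := 0) 1 (degen V (n := 0) 0 x) = x :=
  face_degen_succ V (n := 0) 0 x
lemma face1_0_degen0 (x : V _⦋1⦌) : face V (n := 1) 0 (degen V (n := 1) 0 x) = x :=
  face_degen_self V (n := 1) 0 x
lemma face1_1_degen0 (x : V _⦋1⦌) : face V (n := 1) 1 (degen V (n := 1) 0 x) = x :=
  face_degen_succ V (n := 1) 0 x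
lemma face1_2_degen0 (x : V _⦋1⦌) :
    face V (n := 1) 2 (degen V (n := 1) 0 x) = degen V (n := 0) 0 (face V (n := 0) 1 x) :=
  face_degen_of_gt V (n := 0) (i := 1) (j := 0) (by decide) x
lemma face1_0_degen1 (x : V _⦋1⦌) :
    face V (n := 1) 0 (degen V (n := 1) 1 x) = degen V (n := 0) 0 (face V (n := 0) 0 x) :=
  face_degen_of_le V (n := 0) (i := 0) (j := 0) (by decide) x
lemma face1_1_degen1 (x : V _⦋1⦌) : face V (n := 1) 1 (degen V (n := 1) 1 x) = x :=
  face_degen_self V (n := 1) 1 x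
lemma face1_2_degen1 (x : V _⦋1⦌) : face V (n := 1) 2 (degen V (n := 1) 1 x) = x :=
  face_degen_succ V (n := 1) 1 x
lemma face2_0_degen0 (x : V _⦋2⦌) : face V (n := 2) 0 (degen V (n := 2) 0 x) = x :=
  face_degen_self V (n := 2) 0 x
lemma face2_1_degen0 (x : V _⦋2⦌) : face V (n := 2) 1 (degen V (n := 2) 0 x) = x :=
  face_degen_succ V (n := 2) 0 x
lemma face2_2_degen0 (x : V _⦋2⦌) :
    face V (n := 2) 2 (degen V (n := 2) 0 x) = degen V (n := 1) 0 (face V (n := 1) 1 x) :=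
  face_degen_of_gt V (n := 1) (i := 1) (j := 0) (by decide) x
lemma face2_3_degen0 (x : V _⦋2⦌) :
    face V (n := 2) 3 (degen V (n := 2) 0 x) = degen V (n := 1) 0 (face V (n := 1) 2 x) :=
  face_degen_of_gt V (n := 1) (i := 2) (j := 0) (by decide) x
lemma face2_0_degen1 (x : V _⦋2⦌) :
    face V (n := 2) 0 (degen V (n := 2) 1 x) = degen V (n := 1) 0 (face V (n := 1) 0 x) :=
  face_degen_of_le V (n := 1) (i := 0) (j := 0) (by decide) x
lemma face2_1_degen1 (x : V _⦋2⦌) : face V (n := 2) 1 (degen V (n := 2) 1 x) = x :=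
  face_degen_self V (n := 2) 1 x
lemma face2_2_degen1 (x : V _⦋2⦌) : face V (n := 2) 2 (degen V (n := 2) 1 x) = x :=
  face_degen_succ V (n := 2) 1 x
lemma face2_3_degen1 (x : V _⦋2⦌) :
    face V (n := 2) 3 (degen V (n := 2) 1 x) = degen V (n := 1) 1 (face V (n := 1) 2 x) :=
  face_degen_of_gt V (n := 1) (i := 2) (j := 1) (by decide) x
lemma face2_0_degen2 (x : V _⦋2⦌) :
    face V (n := 2) 0 (degen V (n := 2) 2 x) = degen V (n := 1) 1 (face V (n := 1) 0 x) :=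
  face_degen_of_le V (n := 1) (i := 0) (j := 1) (by decide) x
lemma face2_1_degen2 (x : V _⦋2⦌) :
    face V (n := 2) 1 (degen V (n := 2) 2 x) = degen V (n := 1) 1 (face V (n := 1) 1 x) :=
  face_degen_of_le V (n := 1) (i := 1) (j := 1) (by decide) x
lemma face2_2_degen2 (x : V _⦋2⦌) : face V (n := 2) 2 (degen V (n := 2) 2 x) = x :=
  face_degen_self V (n := 2) 2 x
lemma face2_3_degen2 (x : V _⦋2⦌) : face V (n := 2) 3 (degen V (n := 2) 2 x) = x :=
  face_degen_succ V (n := 2) 2 x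
lemma degen_one_degen_zero (x : V _⦋0⦌) :
    degen V (n := 1) 1 (degen V (n := 0) 0 x) = degen V (n := 1) 0 (degen V (n := 0) 0 x) :=
  (degen_degen V (n := 0) (i := 0) (j := 0) le_rfl x).symm
lemma face_zero_face_one (x : V _⦋2⦌) :
    face V (n := 0) 0 (face V (n := 1) 1 x) = face V (n := 0) 0 (face V (n := 1) 0 x) :=
  face_face V (n := 0) (a := 0) (b := 0) le_rfl x
lemma face_zero_face_two (x : V _⦋2⦌) :
    face V (n := 0) 0 (face V (n := 1) 2 x) = face V (n := 0) 1 (face V (n := 1) 0 x) :=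
  face_face V (n := 0) (a := 0) (b := 1) (by decide) x
lemma face_one_face_two (x : V _⦋2⦌) :
    face V (n := 0) 1 (face V (n := 1) 2 x) = face V (n := 0) 1 (face V (n := 1) 1 x) :=
  face_face V (n := 0) (a := 1) (b := 1) le_rfl x
lemma face1_1_face2_2 (x : V _⦋3⦌) :
    face V (n := 1) 1 (face V (n := 2) 2 x) = face V (n := 1) 1 (face V (n := 2) 1 x) :=
  face_face V (n := 1) (a := 1) (b := 1) le_rfl x
lemma face1_1_face2_3 (x : V _⦋3⦌) :
    face V (n := 1) 1 (face V (n := 2) 3 x) = face V (n := 1) 2 (face V (n := 2) 1 x) :=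
  face_face V (n := 1) (a := 1) (b := 2) (by decide) x
lemma face1_2_face2_3 (x : V _⦋3⦌) :
    face V (n := 1) 2 (face V (n := 2) 3 x) = face V (n := 1) 2 (face V (n := 2) 2 x) :=
  face_face V (n := 1) (a := 2) (b := 2) le_rfl x

end Identities

/-! ### Horn filling in simplicial vector spaces -/

section Horns

variable (V : SVect.{u})

lemma mapsTo_hornMap (n : ℕ) (k : Fin (n + 2)) :
    Set.MapsTo (hornMap V n k) Set.univ (hornSpace V n k) := by
  intro x _
  cases n with
  | zero => trivial
  | succ n => exact fun a b hab _ _ => face_face V hab x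

/-- First half of Moore's argument that simplicial groups are Kan: the faces below k are corrected
in increasing order by adding degenerate elements. -/
lemma exists_faces_eq_of_lt {n : ℕ} {k : Fin (n + 3)}
    {x : {i : Fin (n + 3) // i ≠ k} → V _⦋n + 1⦌} (hx : x ∈ hornSpace V (n + 1) k) (r : ℕ)
    (hr : r ≤ k) :
    ∃ y : V _⦋n + 2⦌, ∀ i : Fin (n + 3), (i : ℕ) < r → ∀ hi : i ≠ k, face V i y = x ⟨i, hi⟩ := by
  induction r with
  | zero => exact ⟨0, fun i hi => absurd hi (Nat.not_lt_zero _)⟩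
  | succ r ih =>
    obtain ⟨y, hy⟩ := ih (by omega)
    have hrn : r < n + 2 := by omega
    let s : Fin (n + 2) := ⟨r, hrn⟩
    have hs : s.castSucc ≠ k := by intro h; rw [← h] at hr; simp [s] at hr
    -- The correction repairs face s. Its lower faces are degeneracies of the faces of the error
    -- term, which vanish by horn compatibility, so nothing already arranged is spoiled.
    refine ⟨y + degen V s (x ⟨s.castSucc, hs⟩ - face V s.castSucc y), fun i hi hik => ?_⟩
    rcases Nat.lt_succ_iff_lt_or_eq.mp hi with hi | hi
    · obtain ⟨r, rfl⟩ : ∃ t, r = t + 1 := ⟨r - 1, by omega⟩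
      obtain ⟨a, rfl⟩ : ∃ a : Fin (n + 2), i = a.castSucc := ⟨⟨i, by omega⟩, rfl⟩
      let b : Fin (n + 1) := ⟨r, by omega⟩
      have hab : a ≤ b.castSucc := by
        rw [Fin.le_def]; simpa [b] using Nat.le_of_lt_succ hi
      have h1 : face V a.castSucc (degen V s (x ⟨s.castSucc, hs⟩ - face V s.castSucc y)) = _ :=
        face_degen_of_le V hab _
      have h2 : face V a (x ⟨s.castSucc, hs⟩) = face V b.castSucc (x ⟨a.castSucc, hik⟩) :=
        hx a b.castSucc hab hik hs
      have h3 : face V a (face V s.castSucc y) = face V b.castSucc (face V a.castSucc y) :=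
        face_face V hab y
      rw [map_add, hy _ hi hik, h1, map_sub, h2, h3, hy _ hi hik, sub_self, map_zero,
        add_zero]
    · obtain rfl : i = s.castSucc := Fin.ext hi
      rw [map_add, face_degen_self]
      abel

/-- Second half of Moore's argument: starting from a filler of the faces below k, the top r faces
are corrected in decreasing order, without disturbing those below k. -/
lemma exists_faces_eq {n : ℕ} {k : Fin (n + 3)}
    {x : {i : Fin (n + 3) // i ≠ k} → V _⦋n + 1⦌} (hx : x ∈ hornSpace V (n + 1) k) (r : ℕ)
    (hr : r + k ≤ n + 2) :
    ∃ y : V _⦋n + 2⦌, ∀ i : Fin (n + 3), i < k ∨ n + 2 < i + r →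
      ∀ hi : i ≠ k, face V i y = x ⟨i, hi⟩ := by
  induction r with
  | zero =>
    obtain ⟨y, hy⟩ := exists_faces_eq_of_lt V hx k le_rfl
    exact ⟨y, fun i hi => hy i (by rcases hi with hi | hi; exacts [hi, by omega])⟩
  | succ r ih =>
    obtain ⟨y, hy⟩ := ih (by omega)
    -- The face to repair is `n + 2 - r`, which is `s.succ`; `σ_s` is chosen because its face `s +
    -- 1` is the identity.
    let s : Fin (n + 2) := ⟨n + 1 - r, by omega⟩
    have hsk : k < s.succ := by rw [Fin.lt_def]; simp [s]; omega
    have hs : s.succ ≠ k := hsk.ne'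
    refine ⟨y + degen V s (x ⟨s.succ, hs⟩ - face V s.succ y), fun i hi hik => ?_⟩
    by_cases his : i = s.succ
    · subst his
      rw [map_add, face_degen_succ]
      abel
    have hi' : i < k ∨ n + 2 < i + r := by
      refine hi.imp_right fun h => ?_
      have : (i : ℕ) ≠ n + 1 - r + 1 := fun h => his (Fin.ext h)
      omega
    rw [map_add, hy i hi' hik]
    suffices face V i (degen V s (x ⟨s.succ, hs⟩ - face V s.succ y)) = 0 by rw [this, add_zero]
    rcases lt_or_ge i s.succ with h | h
    · have hik' : i < k := by
        rcases hi' with h' | h'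
        · exact h'
        · rw [Fin.lt_def] at h
          simp [s] at h
          omega
      have hkv : (k : ℕ) < n + 1 - r + 1 := hsk
      have hiv : (i : ℕ) < k := hik'
      obtain ⟨a, rfl⟩ : ∃ a : Fin (n + 2), i = a.castSucc := ⟨⟨i, by omega⟩, rfl⟩
      rw [Fin.val_castSucc] at hiv
      obtain ⟨b, hb⟩ : ∃ b : Fin (n + 1), s = b.succ :=
        ⟨⟨n - r, by omega⟩, Fin.ext (by simp [s]; omega)⟩
      have has : (a : ℕ) ≤ n - r := by omega
      have hbv : (b : ℕ) = n - r := by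
        have := congrArg Fin.val hb
        simp [s] at this
        omega
      have hab : a ≤ b.castSucc := by
        rw [Fin.le_def, Fin.val_castSucc]; omega
      have has' : a ≤ s := by rw [hb, Fin.le_def, Fin.val_succ]; omega
      have h1 := face_degen_of_le V hab (x ⟨s.succ, hs⟩ - face V s.succ y)
      have h2 : face V a (x ⟨s.succ, hs⟩) = face V s (x ⟨a.castSucc, hik⟩) :=
        hx a s has' hik hs
      rw [← hb] at h1
      rw [h1, map_sub, h2, face_face V has', hy _ hi' hik, sub_self, map_zero]
    · have h' : s.succ < i := lt_of_le_of_ne h (Ne.symm his)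
      obtain ⟨c, rfl⟩ : ∃ c : Fin (n + 2), i = c.succ :=
        ⟨i.pred (Fin.ne_zero_of_lt h'), (Fin.succ_pred _ _).symm⟩
      have hsc : s < c := Fin.succ_lt_succ_iff.mp h'
      have hcv : (c : ℕ) < n + 2 := c.2
      obtain ⟨b, hb⟩ : ∃ b : Fin (n + 1), s = b.castSucc :=
        ⟨⟨s, by have : (s : ℕ) < c := hsc; omega⟩, rfl⟩
      have h1 := face_degen_of_gt V (hb ▸ hsc) (x ⟨s.succ, hs⟩ - face V s.succ y)
      rw [← hb] at h1
      obtain ⟨d, hd⟩ : ∃ d : Fin (n + 2), s.succ = d.castSucc :=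
        ⟨⟨s + 1, by have : (s : ℕ) < c := hsc; omega⟩, rfl⟩
      have hdc : d ≤ c := by
        have := congrArg Fin.val hd
        rw [Fin.val_succ, Fin.val_castSucc] at this
        rw [Fin.le_def]
        have : (s : ℕ) < c := hsc
        omega
      have hdk : d.castSucc ≠ k := hd ▸ hs
      have h2 : face V d (x ⟨c.succ, hik⟩) = face V c (x ⟨d.castSucc, hdk⟩) :=
        hx d c hdc hdk hik
      have h3 := face_face V hdc y
      have h4 : x ⟨s.succ, hs⟩ = x ⟨d.castSucc, hdk⟩ := by congr 1; exact Subtype.ext hd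
      rw [h1, map_sub, h4, ← h2, hd, ← h3, hy _ hi' hik, sub_self, map_zero]

/-- Simplicial vector spaces are Kan. -/
lemma surjOn_hornMap (n : ℕ) (k : Fin (n + 2)) :
    Set.SurjOn (hornMap V n k) Set.univ (hornSpace V n k) := by
  intro x hx
  cases n with
  | zero =>
    -- In `Fin 2` the index other than k is `1 - k`. A horn in degree 1 is a single vertex, filled
    -- by its degeneracy.
    have hk : 1 - k ≠ k := (by decide : ∀ k : Fin 2, 1 - k ≠ k) k
    refine ⟨degen V 0 (x ⟨1 - k, hk⟩), trivial, funext fun ⟨i, hi⟩ => ?_⟩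
    obtain rfl : i = 1 - k := (by decide : ∀ i k : Fin 2, i ≠ k → i = 1 - k) i k hi
    simp only [hornMap]
    generalize x ⟨1 - k, hk⟩ = z
    generalize (1 - k : Fin 2) = i
    fin_cases i
    · exact face_degen_self V 0 z
    · exact face_degen_succ V 0 z
  | succ n =>
    obtain ⟨y, hy⟩ := exists_faces_eq V hx (n + 2 - k) (by omega)
    refine ⟨y, trivial, funext fun ⟨i, hi⟩ => hy i ?_ hi⟩
    have : (i : ℕ) ≠ k := fun h => hi (Fin.ext h)
    rw [Fin.lt_def]
    omega

/-- If only the zero element of `V_{n+1}` has vanishing higher faces, then the horn maps on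
`V_{n+1}` are injective. -/
lemma eq_zero_of_face_eq_zero {n : ℕ}
    (h0 : ∀ x : V _⦋n + 1⦌, (∀ i : Fin (n + 1), face V i.succ x = 0) → x = 0)
    (k : Fin (n + 2)) :
    ∀ x : V _⦋n + 1⦌, (∀ i, i ≠ k → face V i x = 0) → x = 0 := by
  induction k using Fin.induction with
  | zero => exact fun x hx => h0 x fun i => hx _ (Fin.succ_ne_zero i)
  | succ k ih =>
    intro x hx
    -- Subtracting this degenerate element kills face `k + 1` and keeps the other vanishing faces,
    -- at the price of face k. The missing index thus moves from `k + 1` to k, where the induction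
    -- hypothesis applies.
    have key : x - degen V k (face V k.succ x) = 0 := by
      refine ih _ fun i hi => ?_
      rw [map_sub]
      rcases lt_trichotomy i k.succ with h | rfl | h
      · have hik : i < k.castSucc := lt_of_le_of_ne (Fin.le_castSucc_iff.mpr h) hi
        cases n with
        | zero => have := Fin.lt_def.mp hik; simp at this
        | succ n =>
          have hv : (i : ℕ) < k := hik
          obtain ⟨a, rfl⟩ : ∃ a : Fin (n + 2), i = a.castSucc := ⟨⟨i, by omega⟩, rfl⟩
          obtain ⟨b, rfl⟩ : ∃ b : Fin (n + 1), k = b.succ :=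
            ⟨k.pred (by rintro rfl; simp at hv), (Fin.succ_pred _ _).symm⟩
          rw [Fin.val_castSucc, Fin.val_succ] at hv
          have hab : a ≤ b.castSucc := by rw [Fin.le_def, Fin.val_castSucc]; omega
          have hab' : a ≤ b.succ := by rw [Fin.le_def, Fin.val_succ]; omega
          rw [face_degen_of_le V hab, face_face V hab', hx _ h.ne]
          simp
      · rw [face_degen_succ, sub_self]
      · cases n with
        | zero => have h1 := Fin.lt_def.mp h; simp at h1; omega
        | succ n =>
          obtain ⟨c, rfl⟩ : ∃ c : Fin (n + 2), i = c.succ :=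
            ⟨i.pred (Fin.ne_zero_of_lt h), (Fin.succ_pred _ _).symm⟩
          have hkc : k < c := Fin.succ_lt_succ_iff.mp h
          have hv : (k : ℕ) < c := hkc
          obtain ⟨b, rfl⟩ : ∃ b : Fin (n + 1), k = b.castSucc := ⟨⟨k, by omega⟩, rfl⟩
          rw [Fin.val_castSucc] at hv
          have hbc : b.succ ≤ c := by rw [Fin.le_def, Fin.val_succ]; omega
          have e : b.castSucc.succ = b.succ.castSucc := rfl
          rw [face_degen_of_gt V hkc, e, ← face_face V hbc, hx _ h.ne']
          simp
    -- Face k of x vanishes and face k of the correction is face `k + 1` of x, so the latter is zero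
    -- and the correction disappears.
    have hf := congrArg (face V k.castSucc) key
    rw [map_sub, map_zero, face_degen_self,
      hx _ (Fin.castSucc_lt_succ).ne, zero_sub, neg_eq_zero] at hf
    rw [hf] at key
    simpa using key

end Horns

/-! ### Constant normalized cocycles -/

section Cocycles

variable {V : SVect.{u}}

lemma pairA_constForm (ω : LinearMap.BilinForm ℝ (V _⦋2⦌)) (x v : V _⦋0⦌) (w : V _⦋2⦌) :
    pairA V (constForm ω) x v w = ω (degen V (n := 1) 0 (degen V (n := 0) 0 v)) w := rfl

lemma pairB_constForm (ω : LinearMap.BilinForm ℝ (V _⦋2⦌)) (x : V _⦋0⦌) (θ η : V _⦋1⦌) :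
    pairB V (constForm ω) x θ η = ω (degen V (n := 1) 1 θ) (degen V (n := 1) 0 η)
      + ω (degen V (n := 1) 1 η) (degen V (n := 1) 0 θ) := rfl

lemma cobdry_constForm_one (γ : LinearMap.BilinForm ℝ (V _⦋1⦌)) (z x y : V _⦋2⦌) :
    cobdry V (constForm γ) z x y =
      γ (face V (n := 1) 0 x) (face V (n := 1) 0 y) - γ (face V (n := 1) 1 x) (face V (n := 1) 1 y)
        + γ (face V (n := 1) 2 x) (face V (n := 1) 2 y) := by
  simp [cobdry, pullback, constForm, Fin.sum_univ_succ, LinearMap.BilinForm.comp_apply]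
  ring

lemma cobdry_constForm_two (ω : LinearMap.BilinForm ℝ (V _⦋2⦌)) (z x y : V _⦋3⦌) :
    cobdry V (constForm ω) z x y =
      ω (face V (n := 2) 0 x) (face V (n := 2) 0 y) - ω (face V (n := 2) 1 x) (face V (n := 2) 1 y)
        + ω (face V (n := 2) 2 x) (face V (n := 2) 2 y)
        - ω (face V (n := 2) 3 x) (face V (n := 2) 3 y) := by
  have h3 : (Fin.succ 2 : Fin 4) = 3 := rfl
  simp [cobdry, pullback, constForm, Fin.sum_univ_succ, LinearMap.BilinForm.comp_apply]
  ring

lemma pairA_sub (ω ω' : LinearMap.BilinForm ℝ (V _⦋2⦌)) {x v : V _⦋0⦌} {w : V _⦋2⦌} :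
    pairA V (constForm (ω' - ω)) x v w
      = pairA V (constForm ω') x v w - pairA V (constForm ω) x v w := rfl

lemma pairB_sub (ω ω' : LinearMap.BilinForm ℝ (V _⦋2⦌)) {x : V _⦋0⦌} {θ η : V _⦋1⦌} :
    pairB V (constForm (ω' - ω)) x θ η
      = pairB V (constForm ω') x θ η - pairB V (constForm ω) x θ η := by
  simp only [pairB_constForm, LinearMap.sub_apply]
  ring

lemma skewPart_sub (ω ω' : LinearMap.BilinForm ℝ (V _⦋2⦌)) (w w' : kerFace V) :
    skewPart V (ω' - ω) w w' = skewPart V ω' w w' - skewPart V ω w w' := by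
  simp only [skewPart, C32, LinearMap.sub_apply]
  ring

lemma closedForm_constForm {E : Type*} [AddCommGroup E] [Module ℝ E]
    (ω : LinearMap.BilinForm ℝ E) : ClosedForm (constForm ω) := by
  intro x u v w
  simp [constForm, lineDeriv]

lemma isTwoForm_constForm {E : Type*} [AddCommGroup E] [Module ℝ E]
    {ω : LinearMap.BilinForm ℝ E} (h : ω.IsAlt) : IsTwoForm (constForm ω) where
  alt _ := h
  smooth v w _ _ := contDiff_const (c := ω v w)

variable (V) in
/-- Constant 2-forms on `V_2` that are alternating, multiplicative and normalized, in terms of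
elements. -/
structure IsNormalizedCocycle (ω : LinearMap.BilinForm ℝ (V _⦋2⦌)) : Prop where
  alt : ω.IsAlt
  mult : ∀ x y : V _⦋3⦌,
    ω (face V (n := 2) 0 x) (face V (n := 2) 0 y) - ω (face V (n := 2) 1 x) (face V (n := 2) 1 y)
        + ω (face V (n := 2) 2 x) (face V (n := 2) 2 y)
        - ω (face V (n := 2) 3 x) (face V (n := 2) 3 y) = 0
  norm_zero : ∀ θ η, ω (degen V (n := 1) 0 θ) (degen V (n := 1) 0 η) = 0
  norm_one : ∀ θ η, ω (degen V (n := 1) 1 θ) (degen V (n := 1) 1 η) = 0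

lemma IsSymplecticForm.isNormalizedCocycle {ω : LinearMap.BilinForm ℝ (V _⦋2⦌)}
    (h : IsSymplecticForm V (constForm ω)) : IsNormalizedCocycle V ω where
  alt := h.form.alt 0
  mult x y := by
    rw [← cobdry_constForm_two ω 0, h.mult]
    rfl
  norm_zero θ η := LinearMap.congr_fun (LinearMap.congr_fun (h.normalized 0 0) θ) η
  norm_one θ η := LinearMap.congr_fun (LinearMap.congr_fun (h.normalized 1 0) θ) η

lemma IsNormalizedCocycle.isSymplecticForm {ω : LinearMap.BilinForm ℝ (V _⦋2⦌)}
    (h : IsNormalizedCocycle V ω) (hn : SimpliciallyNondegenerate V (constForm ω)) :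
    IsSymplecticForm V (constForm ω) where
  form := isTwoForm_constForm h.alt
  closed := closedForm_constForm ω
  mult z := by
    ext x y
    rw [cobdry_constForm_two, h.mult]
    rfl
  normalized i x := by
    ext θ η
    fin_cases i
    exacts [h.norm_zero θ η, h.norm_one θ η]
  nondeg := hn

namespace IsNormalizedCocycle

variable {ω ω' : LinearMap.BilinForm ℝ (V _⦋2⦌)}

lemma sub (h : IsNormalizedCocycle V ω) (h' : IsNormalizedCocycle V ω') :
    IsNormalizedCocycle V (ω - ω') where
  alt x := by rw [LinearMap.sub_apply, LinearMap.sub_apply, h.alt x, h'.alt x, sub_zero]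
  mult x y := by
    have h1 := h.mult x y
    have h2 := h'.mult x y
    simp only [LinearMap.sub_apply]
    linarith
  norm_zero θ η := by simp [h.norm_zero, h'.norm_zero]
  norm_one θ η := by simp [h.norm_one, h'.norm_one]

lemma add (h : IsNormalizedCocycle V ω) (h' : IsNormalizedCocycle V ω') :
    IsNormalizedCocycle V (ω + ω') where
  alt x := by rw [LinearMap.add_apply, LinearMap.add_apply, h.alt x, h'.alt x, add_zero]
  mult x y := by
    have h1 := h.mult x y
    have h2 := h'.mult x y
    simp only [LinearMap.add_apply]
    linarith
  norm_zero θ η := by simp [h.norm_zero, h'.norm_zero]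
  norm_one θ η := by simp [h.norm_one, h'.norm_one]

lemma pullback {V' : SVect.{u}} {ω : LinearMap.BilinForm ℝ (V' _⦋2⦌)}
    (h : IsNormalizedCocycle V' ω) (φ : V ⟶ V') :
    IsNormalizedCocycle V (ω.comp (level φ 2) (level φ 2)) where
  alt x := h.alt _
  mult x y := by
    simpa only [level_face, LinearMap.BilinForm.comp_apply]
      using h.mult (level φ 3 x) (level φ 3 y)
  norm_zero θ η := by
    have := h.norm_zero (level φ 1 θ) (level φ 1 η)
    rwa [level_degen, level_degen] at this
  norm_one θ η := by
    have := h.norm_one (level φ 1 θ) (level φ 1 η)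
    rwa [level_degen, level_degen] at this

/-! ### Multiplicativity on pairs of degenerate 3-simplices -/

variable (h : IsNormalizedCocycle V ω)
include h

lemma mult_zero_one (x y : V _⦋2⦌) :
    ω x (degen V (n := 1) 0 (face V (n := 1) 0 y)) - ω x y
      + ω (degen V (n := 1) 0 (face V (n := 1) 1 x)) y
      - ω (degen V (n := 1) 0 (face V (n := 1) 2 x)) (degen V (n := 1) 1 (face V (n := 1) 2 y))
      = 0 := by
  simpa only [face2_0_degen0, face2_1_degen0, face2_2_degen0, face2_3_degen0, face2_0_degen1,
    face2_1_degen1, face2_2_degen1, face2_3_degen1]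
    using h.mult (degen V (n := 2) 0 x) (degen V (n := 2) 1 y)

lemma mult_zero_two (x y : V _⦋2⦌) :
    ω x (degen V (n := 1) 1 (face V (n := 1) 0 y)) - ω x (degen V (n := 1) 1 (face V (n := 1) 1 y))
      + ω (degen V (n := 1) 0 (face V (n := 1) 1 x)) y
      - ω (degen V (n := 1) 0 (face V (n := 1) 2 x)) y = 0 := by
  simpa only [face2_0_degen0, face2_1_degen0, face2_2_degen0, face2_3_degen0, face2_0_degen2,
    face2_1_degen2, face2_2_degen2, face2_3_degen2]
    using h.mult (degen V (n := 2) 0 x) (degen V (n := 2) 2 y)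

lemma mult_one_two (x y : V _⦋2⦌) :
    ω (degen V (n := 1) 0 (face V (n := 1) 0 x)) (degen V (n := 1) 1 (face V (n := 1) 0 y))
      - ω x (degen V (n := 1) 1 (face V (n := 1) 1 y)) + ω x y
      - ω (degen V (n := 1) 1 (face V (n := 1) 2 x)) y = 0 := by
  simpa only [face2_0_degen1, face2_1_degen1, face2_2_degen1, face2_3_degen1, face2_0_degen2,
    face2_1_degen2, face2_2_degen2, face2_3_degen2]
    using h.mult (degen V (n := 2) 1 x) (degen V (n := 2) 2 y)

lemma apply_swap (x y : V _⦋2⦌) : ω x y = - ω y x := (h.alt.neg_eq y x).symm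

lemma unit_degen_zero (v : V _⦋0⦌) (θ : V _⦋1⦌) :
    ω (degen V (n := 1) 0 (degen V (n := 0) 0 v)) (degen V (n := 1) 0 θ) = 0 :=
  h.norm_zero _ _

lemma unit_degen_one (v : V _⦋0⦌) (θ : V _⦋1⦌) :
    ω (degen V (n := 1) 0 (degen V (n := 0) 0 v)) (degen V (n := 1) 1 θ) = 0 := by
  rw [← degen_one_degen_zero, h.norm_one]

lemma degen_one_unit (v : V _⦋0⦌) (θ : V _⦋1⦌) :
    ω (degen V (n := 1) 1 θ) (degen V (n := 1) 0 (degen V (n := 0) 0 v)) = 0 := by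
  rw [h.apply_swap, h.unit_degen_one, neg_zero]

lemma pairA_degenerate (v : V _⦋0⦌) {w : V _⦋2⦌} (hw : w ∈ degenerate V 1) :
    pairA V (constForm ω) 0 v w = 0 := by
  have hle : degenerate V 1 ≤ LinearMap.ker
      (ω (degen V (n := 1) 0 (degen V (n := 0) 0 v))) := by
    refine iSup_le fun i => ?_
    rintro _ ⟨θ, rfl⟩
    fin_cases i
    exacts [h.unit_degen_zero v θ, h.unit_degen_one v θ]
  exact hle hw

lemma pairB_degen (θ : V _⦋1⦌) (c : V _⦋0⦌) :
    pairB V (constForm ω) 0 θ (degen V (n := 0) 0 c) = 0 := by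
  rw [pairB_constForm, degen_one_degen_zero, h.degen_one_unit, h.unit_degen_zero, add_zero]

/-- `B_ω` and `A_ω` exchange the two differentials of the tangent complex. -/
lemma pairB_differential (θ : V _⦋1⦌) (z : V _⦋2⦌) :
    pairB V (constForm ω) 0 θ (face V (n := 1) 0 z - face V (n := 1) 1 z + face V (n := 1) 2 z) =
      pairA V (constForm ω) 0 (face V (n := 0) 0 θ - face V (n := 0) 1 θ) z := by
  -- In the second identity minus the first plus the third, the pairings of z with `σ_1 θ` and `σ_0
  -- θ` cancel. The remaining terms assemble into `B` and `A`.
  have h1 := h.mult_zero_one z (degen V (n := 1) 1 θ)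
  have h2 := h.mult_one_two z (degen V (n := 1) 0 θ)
  have h3 := h.mult_zero_two (degen V (n := 1) 0 θ) z
  rw [face1_0_degen1, face1_2_degen1] at h1
  rw [face1_0_degen0, face1_1_degen0] at h2
  rw [face1_1_degen0, face1_2_degen0] at h3
  rw [pairA_constForm, pairB_constForm]
  simp only [map_sub, map_add, LinearMap.sub_apply, LinearMap.add_apply]
  have s1 := h.apply_swap z (degen V (n := 1) 0 (degen V (n := 0) 0 (face V (n := 0) 0 θ)))
  have s2 := h.apply_swap z (degen V (n := 1) 0 θ)
  have s3 := fun η => h.apply_swap (degen V (n := 1) 1 θ) (degen V (n := 1) 0 η)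
  have s4 := fun η => h.apply_swap (degen V (n := 1) 1 η) (degen V (n := 1) 0 θ)
  simp only [s3, s4] at *
  linarith

/-- A normalized cocycle with vanishing `A` and `B` is a coboundary. -/
lemma eq_coboundary (hA : ∀ v w, pairA V (constForm ω) 0 v w = 0)
    (hB : ∀ θ η, pairB V (constForm ω) 0 θ η = 0) (x y : V _⦋2⦌) :
    ω x y = ω (degen V (n := 1) 1 (face V (n := 1) 1 x)) (degen V (n := 1) 0 (face V (n := 1) 1 y))
      - ω (degen V (n := 1) 1 (face V (n := 1) 0 x)) (degen V (n := 1) 0 (face V (n := 1) 0 y))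
      - ω (degen V (n := 1) 1 (face V (n := 1) 2 x)) (degen V (n := 1) 0 (face V (n := 1) 2 y)) := by
  simp only [pairA_constForm] at hA
  simp only [pairB_constForm] at hB
  have hA' : ∀ v w, ω w (degen V (n := 1) 0 (degen V (n := 0) 0 v)) = 0 := fun v w => by
    rw [h.apply_swap, hA, neg_zero]
  have e : ∀ θ η, ω (degen V (n := 1) 0 θ) (degen V (n := 1) 1 η) =
      ω (degen V (n := 1) 1 θ) (degen V (n := 1) 0 η) := fun θ η => by
    rw [h.apply_swap]; linarith [hB θ η]
  have e' : ∀ θ η, ω (degen V (n := 1) 1 θ) (degen V (n := 1) 0 η) =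
      - ω (degen V (n := 1) 1 η) (degen V (n := 1) 0 θ) := fun θ η => by
    linarith [hB θ η]
  -- Vanishing of `B` makes `ω(σ_1 θ, σ_0 η)` skew, and vanishing of `A` removes the unit terms.
  -- Pairings with `σ_1 θ` then reduce to this one form.
  have k : ∀ z θ, ω z (degen V (n := 1) 1 θ) =
      ω (degen V (n := 1) 1 (face V (n := 1) 1 z)) (degen V (n := 1) 0 θ)
        - ω (degen V (n := 1) 1 (face V (n := 1) 2 z)) (degen V (n := 1) 0 θ) := fun z θ => by
    have := h.mult_zero_two z (degen V (n := 1) 1 θ)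
    rw [face1_0_degen1, face1_1_degen1, degen_one_degen_zero, hA', e, e] at this
    linarith
  -- Every term except `ω x y` has a degenerate argument, so `k` and skew-symmetry evaluate them
  -- all.
  have h3 := h.mult_one_two x y
  rw [e, k, h.apply_swap (degen V (n := 1) 1 (face V (n := 1) 2 x)) y, k,
    e' (face V (n := 1) 1 y)] at h3
  rw [e' (face V (n := 1) 2 y)] at h3
  linarith

end IsNormalizedCocycle

/-! ### Coboundaries of constant forms on `V_1` -/

/-- The coboundary `δγ` of a constant 2-form on `V_1`, as a bilinear form. -/
def constCobdry (γ : LinearMap.BilinForm ℝ (V _⦋1⦌)) : LinearMap.BilinForm ℝ (V _⦋2⦌) :=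
  cobdry V (constForm γ) 0

lemma constCobdry_apply (γ : LinearMap.BilinForm ℝ (V _⦋1⦌)) (x y : V _⦋2⦌) :
    constCobdry γ x y =
      γ (face V (n := 1) 0 x) (face V (n := 1) 0 y) - γ (face V (n := 1) 1 x) (face V (n := 1) 1 y)
        + γ (face V (n := 1) 2 x) (face V (n := 1) 2 y) :=
  cobdry_constForm_one γ 0 x y

lemma pairA_constCobdry {γ : LinearMap.BilinForm ℝ (V _⦋1⦌)}
    (hn : ∀ v θ, γ (degen V (n := 0) 0 v) θ = 0) (x v : V _⦋0⦌) (w : V _⦋2⦌) :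
    pairA V (constForm (constCobdry γ)) x v w = 0 := by
  rw [pairA_constForm, constCobdry_apply, face1_0_degen0, face1_1_degen0, face1_2_degen0,
    face0_1_degen0, hn, hn, hn]
  ring

section Coboundaries

variable {γ : LinearMap.BilinForm ℝ (V _⦋1⦌)} (hγ : γ.IsAlt)
  (hn : ∀ v θ, γ (degen V (n := 0) 0 v) θ = 0)
include hγ hn

lemma apply_degen_eq_zero (v : V _⦋0⦌) (θ : V _⦋1⦌) : γ θ (degen V (n := 0) 0 v) = 0 := by
  rw [← hγ.neg_eq, hn, neg_zero]

/-- Multiplicativity is `δδ = 0`: after the simplicial identities the twelve terms cancel in pairs.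
Normalization holds because γ kills degenerate vectors. -/
lemma isNormalizedCocycle_constCobdry : IsNormalizedCocycle V (constCobdry γ) where
  alt x := by
    rw [constCobdry_apply, hγ, hγ, hγ]
    simp
  mult x y := by
    have e1 := face_face V (n := 1) (a := 0) (b := 0) le_rfl
    have e2 := face_face V (n := 1) (a := 0) (b := 1) (by decide)
    have e3 := face_face V (n := 1) (a := 0) (b := 2) (by decide)
    have e4 := face_face V (n := 1) (a := 1) (b := 1) le_rfl
    have e5 := face_face V (n := 1) (a := 1) (b := 2) (by decide)
    have e6 := face_face V (n := 1) (a := 2) (b := 2) le_rfl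
    have s0 : (Fin.succ 0 : Fin 4) = 1 := rfl
    have s1 : (Fin.succ 1 : Fin 4) = 2 := rfl
    have s2 : (Fin.succ 2 : Fin 4) = 3 := rfl
    have c0 : (Fin.castSucc 0 : Fin 4) = 0 := rfl
    have c1 : (Fin.castSucc 1 : Fin 4) = 1 := rfl
    have c2 : (Fin.castSucc 2 : Fin 4) = 2 := rfl
    simp only [Nat.reduceAdd, s0, s1, s2, c0, c1, c2] at e1 e2 e3 e4 e5 e6
    simp only [constCobdry_apply]
    simp only [e1, e2, e3, e4, e5, e6]
    ring
  norm_zero θ η := by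
    rw [constCobdry_apply, face1_0_degen0, face1_0_degen0, face1_1_degen0, face1_1_degen0,
      face1_2_degen0, hn]
    ring
  norm_one θ η := by
    rw [constCobdry_apply, face1_0_degen1, face1_1_degen1, face1_1_degen1,
      face1_2_degen1, face1_2_degen1, hn]
    ring

/-- The mixed pairing recovers γ up to sign. Since γ is alternating, its symmetrization, which is
`B`, vanishes, while the skew part sees all of γ on `ker f_0`. -/
lemma constCobdry_degen (θ η : V _⦋1⦌) :
    constCobdry γ (degen V (n := 1) 1 θ) (degen V (n := 1) 0 η) = - γ θ η := by
  rw [constCobdry_apply, face1_0_degen0, face1_1_degen0, face1_2_degen0, face1_0_degen1,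
    face1_1_degen1, hn, apply_degen_eq_zero hγ hn]
  ring

lemma pairB_constCobdry (x : V _⦋0⦌) (θ η : V _⦋1⦌) :
    pairB V (constForm (constCobdry γ)) x θ η = 0 := by
  rw [pairB_constForm, constCobdry_degen hγ hn, constCobdry_degen hγ hn, ← hγ.neg_eq θ η]
  ring

lemma formEquiv_of_sub_eq_constCobdry {ω ω' : LinearMap.BilinForm ℝ (V _⦋2⦌)}
    (h : ω' - ω = constCobdry γ) : FormEquiv V (constForm ω) (constForm ω') := by
  refine ⟨constForm γ, isTwoForm_constForm hγ, closedForm_constForm γ, fun i x => ?_, fun x => h,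
    pairA_constCobdry hn, pairB_constCobdry hγ hn⟩
  ext v w
  obtain rfl : i = 0 := Fin.eq_zero i
  exact hn v _

end Coboundaries

/-- The 2-form `γ(θ, η) = ω(σ_1 θ, σ_0 η)` on `V_1`. -/
def crossForm (ω : LinearMap.BilinForm ℝ (V _⦋2⦌)) : LinearMap.BilinForm ℝ (V _⦋1⦌) :=
  ω.compl₁₂ (degen V (n := 1) 1) (degen V (n := 1) 0)

lemma crossForm_apply (ω : LinearMap.BilinForm ℝ (V _⦋2⦌)) (θ η : V _⦋1⦌) :
    crossForm ω θ η = ω (degen V (n := 1) 1 θ) (degen V (n := 1) 0 η) := rfl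

namespace IsNormalizedCocycle

variable {ω ω' : LinearMap.BilinForm ℝ (V _⦋2⦌)}

lemma formEquiv (h : IsNormalizedCocycle V ω) (h' : IsNormalizedCocycle V ω')
    (hA : ∀ v w, pairA V (constForm ω') 0 v w = pairA V (constForm ω) 0 v w)
    (hB : ∀ θ η, pairB V (constForm ω') 0 θ η = pairB V (constForm ω) 0 θ η) :
    FormEquiv V (constForm ω) (constForm ω') := by
  have hd := h'.sub h
  have hA' : ∀ v w, pairA V (constForm (ω' - ω)) 0 v w = 0 := fun v w => by
    rw [pairA_sub, hA, sub_self]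
  have hB' : ∀ θ η, pairB V (constForm (ω' - ω)) 0 θ η = 0 := fun θ η => by
    rw [pairB_sub, hB, sub_self]
  -- The primitive is read off from `eq_coboundary`. It is alternating because `B` of the difference
  -- on the diagonal is twice the cross form.
  refine formEquiv_of_sub_eq_constCobdry (γ := - crossForm (ω' - ω)) ?_ ?_ ?_
  · intro θ
    have := hB' θ θ
    rw [pairB_constForm] at this
    simp only [LinearMap.neg_apply, crossForm_apply]
    linarith
  · intro v θ
    rw [LinearMap.neg_apply, LinearMap.neg_apply, crossForm_apply, degen_one_degen_zero,
      hd.unit_degen_zero, neg_zero]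
  · ext x y
    rw [hd.eq_coboundary hA' hB', constCobdry_apply]
    simp only [LinearMap.neg_apply, crossForm_apply]
    ring

/-- A normalized cocycle with vanishing `A`, `B` and skew part is zero. -/
lemma eq_zero (h : IsNormalizedCocycle V ω) (hA : ∀ v w, pairA V (constForm ω) 0 v w = 0)
    (hB : ∀ θ η, pairB V (constForm ω) 0 θ η = 0) (hr : ∀ w w', skewPart V ω w w' = 0) :
    ω = 0 := by
  -- By normalization `C32` is the cross form restricted to `ker f_0`; `hr` kills its skew part and
  -- `hB` its symmetric part.
  have key : ∀ w w' : kerFace V, ω (degen V (n := 1) 1 (w : V _⦋1⦌))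
      (degen V (n := 1) 0 (w' : V _⦋1⦌)) = 0 := fun w w' => by
    have h1 := hr w w'
    have h2 := hB w w'
    rw [pairB_constForm] at h2
    simp only [skewPart, C32, map_sub, h.norm_one] at h1
    linarith
  have hmem : ∀ θ : V _⦋1⦌, θ - degen V (n := 0) 0 (face V (n := 0) 0 θ) ∈ kerFace V := fun θ => by
    rw [LinearMap.mem_ker, map_sub, face0_0_degen0, sub_self]
  have key' : ∀ θ η, ω (degen V (n := 1) 1 θ) (degen V (n := 1) 0 η) = 0 := fun θ η => by
    have := key ⟨_, hmem θ⟩ ⟨_, hmem η⟩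
    simpa only [map_sub, LinearMap.sub_apply, h.degen_one_unit, degen_one_degen_zero,
      h.unit_degen_zero, sub_zero] using this
  ext x y
  rw [h.eq_coboundary hA hB, key', key', key']
  simp

end IsNormalizedCocycle

/-- The projection of `V_1` onto `ker f_0` along the degenerate subspace. -/
def projKerFace (V : SVect.{u}) : V _⦋1⦌ →ₗ[ℝ] kerFace V :=
  (LinearMap.id - (degen V (n := 0) 0).comp (face V (n := 0) 0)).codRestrict _ fun θ => by
    simp [face0_0_degen0]

lemma coe_projKerFace (θ : V _⦋1⦌) :
    (projKerFace V θ : V _⦋1⦌) = θ - degen V (n := 0) 0 (face V (n := 0) 0 θ) := rfl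

lemma projKerFace_coe (w : kerFace V) : projKerFace V (w : V _⦋1⦌) = w := by
  ext
  rw [coe_projKerFace, LinearMap.mem_ker.mp w.2, map_zero, sub_zero]

lemma projKerFace_degen (c : V _⦋0⦌) : projKerFace V (degen V (n := 0) 0 c) = 0 := by
  ext
  simp [coe_projKerFace, face0_0_degen0]

/-! ### Equivalence of constant forms and the freedom of the skew part -/

lemma FormEquiv.pairA_eq {ω ω' : V _⦋2⦌ → LinearMap.BilinForm ℝ (V _⦋2⦌)} (h : FormEquiv V ω ω')
    (x v : V _⦋0⦌) (w : V _⦋2⦌) : pairA V ω' x v w = pairA V ω x v w := by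
  obtain ⟨α, -, -, -, h4, h5, -⟩ := h
  have := h5 x v w
  rw [pairA, ← h4, LinearMap.sub_apply, LinearMap.sub_apply] at this
  exact sub_eq_zero.mp this

lemma FormEquiv.pairB_eq {ω ω' : V _⦋2⦌ → LinearMap.BilinForm ℝ (V _⦋2⦌)} (h : FormEquiv V ω ω')
    (x : V _⦋0⦌) (θ η : V _⦋1⦌) : pairB V ω' x θ η = pairB V ω x θ η := by
  obtain ⟨α, -, -, -, h4, -, h6⟩ := h
  have := h6 x θ η
  simp only [pairB, ← h4, LinearMap.sub_apply] at this ⊢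
  linarith

/-- Non-constant primitives give no additional equivalences: any primitive preserves `A` and `B` by
definition, and when these agree a constant primitive exists. Nondegeneracy plays no role. -/
theorem formEquiv_iff {ω ω' : LinearMap.BilinForm ℝ (V _⦋2⦌)}
    (h : IsNormalizedCocycle V ω) (h' : IsNormalizedCocycle V ω') :
    FormEquiv V (constForm ω) (constForm ω') ↔
      (∀ v w, pairA V (constForm ω') 0 v w = pairA V (constForm ω) 0 v w) ∧
      (∀ θ η, pairB V (constForm ω') 0 θ η = pairB V (constForm ω) 0 θ η) :=
  ⟨fun e => ⟨e.pairA_eq 0, e.pairB_eq 0⟩, fun e => h.formEquiv h' e.1 e.2⟩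

lemma exists_isAlt_eq_skewPart (ω : LinearMap.BilinForm ℝ (V _⦋2⦌)) :
    ∃ r : LinearMap.BilinForm ℝ (kerFace V), r.IsAlt ∧ ∀ w w', r w w' = skewPart V ω w w' := by
  let c : LinearMap.BilinForm ℝ (kerFace V) :=
    (crossForm ω - ω.compl₁₂ (degen V (n := 1) 1) (degen V (n := 1) 1)).compl₁₂
      (kerFace V).subtype (kerFace V).subtype
  have hc : ∀ w w', c w w' = C32 V ω w w' := fun w w' => by
    simp [c, crossForm_apply, C32]
  refine ⟨(2⁻¹ : ℝ) • (c - c.flip), fun w => by simp, fun w w' => ?_⟩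
  simp only [LinearMap.smul_apply, LinearMap.sub_apply, LinearMap.BilinForm.flip_apply, hc, skewPart,
    smul_eq_mul]
  ring

theorem existsUnique_skewPart {ω : LinearMap.BilinForm ℝ (V _⦋2⦌)}
    (h : IsSymplecticForm V (constForm ω)) {r : LinearMap.BilinForm ℝ (kerFace V)}
    (hr : r.IsAlt) :
    ∃! ω' : LinearMap.BilinForm ℝ (V _⦋2⦌), IsSymplecticForm V (constForm ω') ∧
      FormEquiv V (constForm ω) (constForm ω') ∧ ∀ w w', skewPart V ω' w w' = r w w' := by
  have hω := h.isNormalizedCocycle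
  obtain ⟨s, hs, hs'⟩ := exists_isAlt_eq_skewPart ω
  -- Adding `δγ` lowers the skew part by the restriction of γ to `ker f_0`, so `s - r` turns the
  -- given skew part s into r. Projecting along degenerate vectors makes γ normalized.
  let γ : LinearMap.BilinForm ℝ (V _⦋1⦌) := (s - r).compl₁₂ (projKerFace V) (projKerFace V)
  have hγ : γ.IsAlt := fun θ => by simp [γ, hs _, hr _]
  have hn : ∀ v θ, γ (degen V (n := 0) 0 v) θ = 0 := fun v θ => by
    simp only [γ, LinearMap.compl₁₂_apply, projKerFace_degen, map_zero, LinearMap.zero_apply]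
  have hγc := isNormalizedCocycle_constCobdry hγ hn
  have hsum := hω.add hγc
  have heq : FormEquiv V (constForm ω) (constForm (ω + constCobdry γ)) :=
    formEquiv_of_sub_eq_constCobdry hγ hn (by abel)
  have hskew : ∀ w w', skewPart V (ω + constCobdry γ) w w' = r w w' := fun w w' => by
    have e := hs' w w'
    have e2 : r w' w = - r w w' := (hr.neg_eq w w').symm
    have e3 : s w' w = - s w w' := (hs.neg_eq w w').symm
    simp only [skewPart, C32, map_sub, hω.norm_one, hsum.norm_one] at e ⊢
    simp only [LinearMap.add_apply, constCobdry_degen hγ hn, γ, LinearMap.compl₁₂_apply,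
      projKerFace_coe, LinearMap.sub_apply]
    linarith
  -- Nondegeneracy involves only `A` and `B`, which equivalence preserves.
  refine ⟨ω + constCobdry γ, ⟨hsum.isSymplecticForm ⟨fun x v hv => h.nondeg.left_A x v fun w => ?_,
    fun x w hw => h.nondeg.right_A x w fun v => ?_, fun x θ hθ => h.nondeg.nondeg_B x θ fun η => ?_⟩,
    heq, hskew⟩, ?_⟩
  · rw [← heq.pairA_eq]; exact hv w
  · rw [← heq.pairA_eq]; exact hw v
  · rw [← heq.pairB_eq]; exact hθ η
  · rintro ω'' ⟨h1, h2, h3⟩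
    have heq' := heq.symm.trans h2
    refine sub_eq_zero.mp ((h1.isNormalizedCocycle.sub hsum).eq_zero (fun v w => ?_)
      (fun θ η => ?_) fun w w' => ?_)
    · rw [pairA_sub, heq'.pairA_eq, sub_self]
    · rw [pairB_sub, heq'.pairB_eq, sub_self]
    · rw [skewPart_sub, h3, hskew, sub_self]

end Cocycles

/-! ### The Dold–Kan correspondence for simplicial vector spaces -/

section DoldKan

open AlgebraicTopology

/-- The normalized subspace of `V_n`: the common kernel of the faces `f_1, …, f_n`. -/
def normSub (V : SVect.{u}) (n : ℕ) : Submodule ℝ (V _⦋n⦌) :=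
  match n with
  | 0 => ⊤
  | n + 1 => ⨅ i : Fin (n + 1), LinearMap.ker (face V i.succ)

variable {V V' : SVect.{u}}

lemma mem_normSub_succ {n : ℕ} {x : V _⦋n + 1⦌} :
    x ∈ normSub V (n + 1) ↔ ∀ i : Fin (n + 1), face V i.succ x = 0 := by
  simp [normSub]

lemma face_zero_mem_normSub {n : ℕ} {x : V _⦋n + 1⦌} (hx : x ∈ normSub V (n + 1)) :
    face V 0 x ∈ normSub V n := by
  cases n with
  | zero => trivial
  | succ n =>
    rw [mem_normSub_succ] at hx ⊢
    intro i
    have h := face_face V (a := 0) (b := i.succ) (Fin.zero_le _) x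
    rw [hx, map_zero] at h
    exact h.symm

/-- The inclusion of the `n`-th term of the normalized Moore complex. -/
def mooreArrow (V : SVect.{u}) (n : ℕ) :
    ((normalizedMooreComplex (ModuleCat.{u} ℝ)).obj V).X n ⟶ V _⦋n⦌ :=
  (NormalizedMooreComplex.objX V n).arrow

instance (n : ℕ) : Mono (mooreArrow V n) :=
  inferInstanceAs (Mono (NormalizedMooreComplex.objX V n).arrow)

lemma mooreArrow_comp_δ (n : ℕ) (i : Fin (n + 1)) : mooreArrow V (n + 1) ≫ V.δ i.succ = 0 := by
  have h := Subobject.factorThru_arrow _ _ (Subobject.finset_inf_arrow_factors Finset.univ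
    (fun k : Fin (n + 1) => Limits.kernelSubobject (V.δ k.succ)) i (by simp))
  change (NormalizedMooreComplex.objX V (n + 1)).arrow ≫ V.δ i.succ = 0
  refine (congrArg (· ≫ V.δ i.succ) h.symm).trans ?_
  rw [Category.assoc, Limits.kernelSubobject_arrow_comp, Limits.comp_zero]
  rfl

lemma d_comp_mooreArrow (n : ℕ) :
    ((normalizedMooreComplex (ModuleCat.{u} ℝ)).obj V).d (n + 1) n ≫ mooreArrow V n
      = mooreArrow V (n + 1) ≫ V.δ 0 := by
  rw [normalizedMooreComplex_objD]
  cases n with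
  | zero =>
    simp only [NormalizedMooreComplex.objD, mooreArrow]
    erw [Category.assoc, Category.assoc, IsIso.inv_hom_id, Category.comp_id]
  | succ n =>
    simp only [NormalizedMooreComplex.objD, mooreArrow]
    erw [Subobject.factorThru_arrow]
    rfl

lemma map_comp_mooreArrow (φ : V ⟶ V') (n : ℕ) :
    ((normalizedMooreComplex (ModuleCat.{u} ℝ)).map φ).f n ≫ mooreArrow V' n
      = mooreArrow V n ≫ φ.app (Opposite.op ⦋n⦌) := by
  rw [normalizedMooreComplex_map, NormalizedMooreComplex.map_f]
  exact Subobject.factorThru_arrow _ _ _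

/-- The Moore complex is defined by an abstract intersection of kernel subobjects. The inclusion of
the concrete submodule factors through it, which gives the nontrivial containment. -/
lemma range_mooreArrow (n : ℕ) : LinearMap.range (mooreArrow V n).hom = normSub V n := by
  apply le_antisymm
  · rintro _ ⟨x, rfl⟩
    cases n with
    | zero => trivial
    | succ n =>
      rw [mem_normSub_succ]
      exact fun i => LinearMap.congr_fun
        (congrArg ModuleCat.Hom.hom (mooreArrow_comp_δ (V := V) n i)) x
  · intro x hx
    let ι : ModuleCat.of ℝ (normSub V n) ⟶ V _⦋n⦌ := ModuleCat.ofHom (normSub V n).subtype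
    have hf : (NormalizedMooreComplex.objX V n).Factors ι := by
      cases n with
      | zero => exact Subobject.top_factors _
      | succ n =>
        refine (Subobject.finset_inf_factors _).mpr fun i _ => Limits.kernelSubobject_factors _ _ ?_
        ext y
        exact mem_normSub_succ.mp y.2 i
    exact ⟨(NormalizedMooreComplex.objX V n).factorThru ι hf ⟨x, hx⟩, LinearMap.congr_fun
      (congrArg ModuleCat.Hom.hom (Subobject.factorThru_arrow _ ι hf)) ⟨x, hx⟩⟩

/-- The terms of the normalized Moore complex are the normalized subspaces. -/
def mooreEquiv (V : SVect.{u}) (n : ℕ) :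
    ((normalizedMooreComplex (ModuleCat.{u} ℝ)).obj V).X n ≃ₗ[ℝ] normSub V n :=
  (LinearEquiv.ofInjective (mooreArrow V n).hom
    ((ModuleCat.mono_iff_injective _).mp inferInstance)).trans
      (LinearEquiv.ofEq _ _ (range_mooreArrow n))

lemma coe_mooreEquiv_d (n : ℕ) (x) :
    (mooreEquiv V n ((((normalizedMooreComplex (ModuleCat.{u} ℝ)).obj V).d (n + 1) n).hom x) :
      V _⦋n⦌) = face V 0 (mooreEquiv V (n + 1) x : V _⦋n + 1⦌) :=
  LinearMap.congr_fun (congrArg ModuleCat.Hom.hom (d_comp_mooreArrow (V := V) n)) x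

/-- An isomorphism of normalized complexes extends to an isomorphism of simplicial vector
spaces. -/
theorem exists_iso_of_normSub_equiv (e : ∀ n, normSub V n ≃ₗ[ℝ] normSub V' n)
    (he : ∀ n (x : normSub V (n + 1)),
      (e n ⟨face V 0 (x : V _⦋n + 1⦌), face_zero_mem_normSub x.2⟩ : V' _⦋n⦌)
        = face V' 0 (e (n + 1) x : V' _⦋n + 1⦌)) :
    ∃ φ : V ≅ V', ∀ n (x : normSub V n), level φ.hom n x = e n x := by
  let N := normalizedMooreComplex (ModuleCat.{u} ℝ)
  let c : ∀ n, (N.obj V).X n ≃ₗ[ℝ] (N.obj V').X n := fun n =>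
    (mooreEquiv V n).trans ((e n).trans (mooreEquiv V' n).symm)
  have hc : ∀ n x, mooreEquiv V' n (c n x) = e n (mooreEquiv V n x) := fun n x => by simp [c]
  -- Under `mooreEquiv` the differential becomes `f_0`, so `he` says that the components form a
  -- chain map. Fullness and faithfulness of the normalized complex functor then lift the
  -- isomorphism.
  let ψ : N.obj V ≅ N.obj V' := HomologicalComplex.Hom.isoOfComponents
    (fun n => (c n).toModuleIso) (by
      rintro i n (rfl : n + 1 = i)
      ext x
      apply (mooreEquiv V' n).injective
      apply Subtype.ext
      have h1 := coe_mooreEquiv_d (V := V') n (c (n + 1) x)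
      have h2 := he n (mooreEquiv V (n + 1) x)
      have h3 := coe_mooreEquiv_d (V := V) n x
      have h4 : mooreEquiv V n (((N.obj V).d (n + 1) n).hom x) =
        ⟨face V 0 (mooreEquiv V (n + 1) x : V _⦋n + 1⦌), face_zero_mem_normSub (Subtype.prop _)⟩ :=
        Subtype.ext h3
      rw [hc, ← h2, ← h4, ← hc] at h1
      exact h1)
  have : N.IsEquivalence :=
    inferInstanceAs (CategoryTheory.Abelian.DoldKan.equivalence (A := ModuleCat.{u} ℝ)).functor.IsEquivalence
  refine ⟨N.preimageIso ψ, fun n x => ?_⟩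
  obtain ⟨x, rfl⟩ := (mooreEquiv V n).surjective x
  have h1 := LinearMap.congr_fun (congrArg ModuleCat.Hom.hom
    (map_comp_mooreArrow (N.preimageIso ψ).hom n)) x
  have h2 : N.map (N.preimageIso ψ).hom = ψ.hom := by simp
  rw [← hc]
  refine Eq.trans h1.symm ?_
  change (mooreArrow V' n).hom (((N.map (N.preimageIso ψ).hom).f n).hom x) = _
  rw [h2]
  rfl

/-- Every chain complex is the normalized complex of a simplicial vector space. -/
theorem exists_normSub_equiv (C : ChainComplex (ModuleCat.{u} ℝ) ℕ) :
    ∃ (V : SVect.{u}) (e : ∀ n, C.X n ≃ₗ[ℝ] normSub V n),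
      ∀ n x, face V 0 (e (n + 1) x : V _⦋n + 1⦌) = e n ((C.d (n + 1) n).hom x) := by
  let N := normalizedMooreComplex (ModuleCat.{u} ℝ)
  have : N.IsEquivalence :=
    inferInstanceAs (CategoryTheory.Abelian.DoldKan.equivalence (A := ModuleCat.{u} ℝ)).functor.IsEquivalence
  -- This direction uses essential surjectivity of the same equivalence.
  let ψ : C ≅ N.obj (N.objPreimage C) := (N.objObjPreimageIso C).symm
  refine ⟨N.objPreimage C, fun n => ((HomologicalComplex.eval _ _ n).mapIso ψ).toLinearEquiv.trans
    (mooreEquiv _ n), fun n x => ?_⟩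
  have h := LinearMap.congr_fun (congrArg ModuleCat.Hom.hom (ψ.hom.comm (n + 1) n)) x
  have h1 := coe_mooreEquiv_d (V := N.objPreimage C) n ((ψ.hom.f (n + 1)).hom x)
  refine h1.symm.trans ?_
  exact congrArg (fun z => (mooreEquiv (N.objPreimage C) n z : (N.objPreimage C) _⦋n⦌)) h

end DoldKan

/-! ### Linear 2-groupoids and their normalized complexes -/

section Normalized

variable {V : SVect.{u}}

/-- A normalized element has the same 0-th horn as zero, and fillers are unique in these degrees. -/
lemma IsLinearTwoGroupoid.normSub_eq_bot (h : IsLinearTwoGroupoid V) (n : ℕ) :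
    normSub V (n + 3) = ⊥ := by
  refine (Submodule.eq_bot_iff _).mpr fun x hx => ?_
  rw [mem_normSub_succ] at hx
  refine (h.horn_bij (n + 2) 0 (by omega)).injOn trivial trivial (funext fun ⟨i, hi⟩ => ?_)
  obtain ⟨j, rfl⟩ := Fin.exists_succ_eq.mpr hi
  simp only [hornMap, hx j, map_zero]

/-- The normalized subspace is the kernel of the map to finitely many copies of the previous level,
so finiteness propagates upward. -/
lemma finiteDimensional_of_normSub (h : ∀ n, FiniteDimensional ℝ (normSub V n)) (n : ℕ) :
    FiniteDimensional ℝ (V _⦋n⦌) := by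
  induction n with
  | zero =>
    have : FiniteDimensional ℝ (⊤ : Submodule ℝ (V _⦋0⦌)) := h 0
    exact Module.Finite.equiv (Submodule.topEquiv : (⊤ : Submodule ℝ (V _⦋0⦌)) ≃ₗ[ℝ] _)
  | succ n ih =>
    let F : V _⦋n + 1⦌ →ₗ[ℝ] (Fin (n + 1) → V _⦋n⦌) := LinearMap.pi fun i => face V i.succ
    have hk : LinearMap.ker F = normSub V (n + 1) := by
      ext x
      rw [mem_normSub_succ, LinearMap.mem_ker, funext_iff]
      rfl
    have := h (n + 1)
    rw [← hk] at this
    have : FiniteDimensional ℝ (V _⦋n + 1⦌ ⧸ LinearMap.ker F) :=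
      Module.Finite.equiv F.quotKerEquivRange.symm
    exact Module.Finite.of_submodule_quotient (LinearMap.ker F)

lemma isLinearTwoGroupoid_of_normSub (h : ∀ n, FiniteDimensional ℝ (normSub V n))
    (h3 : ∀ n, normSub V (n + 3) = ⊥) : IsLinearTwoGroupoid V where
  finite := finiteDimensional_of_normSub h
  horn_surj := surjOn_hornMap V
  horn_bij n k hn := by
    refine ⟨mapsTo_hornMap V n k, fun x _ y _ hxy => ?_, surjOn_hornMap V n k⟩
    obtain ⟨m, rfl⟩ : ∃ m, n = m + 2 := ⟨n - 2, by omega⟩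
    refine sub_eq_zero.mp (eq_zero_of_face_eq_zero V (fun x hx => ?_) k _ fun i hi => ?_)
    · exact (Submodule.eq_bot_iff _).mp (h3 m) x (mem_normSub_succ.mpr hx)
    · rw [map_sub, sub_eq_zero]
      exact congrFun hxy ⟨i, hi⟩

lemma mem_normSub_one {x : V _⦋1⦌} : x ∈ normSub V 1 ↔ face V (n := 0) 1 x = 0 := by
  rw [mem_normSub_succ]
  exact ⟨fun h => h 0, fun h i => by obtain rfl := Fin.eq_zero i; exact h⟩

lemma mem_normSub_two {x : V _⦋2⦌} :
    x ∈ normSub V 2 ↔ face V (n := 1) 1 x = 0 ∧ face V (n := 1) 2 x = 0 := by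
  rw [mem_normSub_succ, Fin.forall_fin_two]
  rfl

/-! ### Projections onto the normalized subspaces -/

variable (V) in
/-- The projection of `V_1` onto its normalized subspace along the degenerate subspace. -/
def projOne : V _⦋1⦌ →ₗ[ℝ] normSub V 1 :=
  (LinearMap.id - (degen V (n := 0) 0).comp (face V (n := 0) 1)).codRestrict _ fun θ => by
    simp [mem_normSub_one, face0_1_degen0]

lemma coe_projOne (θ : V _⦋1⦌) :
    (projOne V θ : V _⦋1⦌) = θ - degen V (n := 0) 0 (face V (n := 0) 1 θ) := rfl

lemma projOne_coe (u : normSub V 1) : projOne V (u : V _⦋1⦌) = u := by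
  ext
  rw [coe_projOne, mem_normSub_one.mp u.2, map_zero, sub_zero]

lemma projOne_degen (c : V _⦋0⦌) : projOne V (degen V (n := 0) 0 c) = 0 := by
  ext
  simp [coe_projOne, face0_1_degen0]

variable (V) in
/-- The projection of `V_2` onto its normalized subspace along the degenerate subspace. -/
def projTwo : V _⦋2⦌ →ₗ[ℝ] normSub V 2 :=
  ((LinearMap.id - (degen V (n := 1) 0).comp (face V (n := 1) 1)).comp
    (LinearMap.id - (degen V (n := 1) 1).comp (face V (n := 1) 2))).codRestrict _ fun z => by
    simp [mem_normSub_two, face1_1_degen0, face1_2_degen0, face1_1_degen1, face1_2_degen1,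
      face_one_face_two]

lemma coe_projTwo (z : V _⦋2⦌) :
    (projTwo V z : V _⦋2⦌) = z - degen V (n := 1) 1 (face V (n := 1) 2 z)
      - degen V (n := 1) 0 (face V (n := 1) 1 (z - degen V (n := 1) 1 (face V (n := 1) 2 z))) := rfl

lemma projTwo_coe (u : normSub V 2) : projTwo V (u : V _⦋2⦌) = u := by
  ext
  have h := mem_normSub_two.mp u.2
  simp [coe_projTwo, h.1, h.2]

lemma projTwo_degen_zero (θ : V _⦋1⦌) : projTwo V (degen V (n := 1) 0 θ) = 0 := by
  ext
  simp [coe_projTwo, face1_1_degen0, face1_2_degen0, degen_one_degen_zero]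

lemma projTwo_degen_one (θ : V _⦋1⦌) : projTwo V (degen V (n := 1) 1 θ) = 0 := by
  ext
  simp [coe_projTwo, face1_2_degen1]

lemma degen_mem_degenerate {n : ℕ} (i : Fin (n + 1)) (x : V _⦋n⦌) :
    degen V i x ∈ degenerate V n :=
  Submodule.mem_iSup_of_mem i ⟨x, rfl⟩

lemma sub_projTwo_mem_degenerate (z : V _⦋2⦌) : z - projTwo V z ∈ degenerate V 1 := by
  rw [coe_projTwo, sub_sub, sub_sub_cancel]
  exact add_mem (degen_mem_degenerate 1 _) (degen_mem_degenerate 0 _)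

lemma exists_eq_degen_of_mem_degenerate {x : V _⦋1⦌} (hx : x ∈ degenerate V 0) :
    ∃ c, x = degen V (n := 0) 0 c := by
  have h : degenerate V 0 ≤ LinearMap.range (degen V (n := 0) 0) :=
    iSup_le fun i => by obtain rfl := Fin.eq_zero i; exact le_rfl
  obtain ⟨c, rfl⟩ := h hx
  exact ⟨c, rfl⟩

lemma projTwo_eq_zero {z : V _⦋2⦌} (hz : z ∈ degenerate V 1) : projTwo V z = 0 := by
  have h : degenerate V 1 ≤ LinearMap.ker (projTwo V) := by
    refine iSup_le fun i => ?_
    rintro _ ⟨θ, rfl⟩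
    fin_cases i
    exacts [projTwo_degen_zero θ, projTwo_degen_one θ]
  exact h hz

/-- If the normalized complex vanishes in degree 3, then `V_3` is degenerate. -/
lemma exists_eq_degen_add (h3 : normSub V 3 = ⊥) (x : V _⦋3⦌) :
    ∃ a b c : V _⦋2⦌, x = degen V (n := 2) 0 a + degen V (n := 2) 1 b + degen V (n := 2) 2 c := by
  -- Faces 3, 2 and 1 are killed in this order by subtracting degenerate elements; each subtraction
  -- preserves the zeros already obtained. The remainder is normalized, hence zero.
  let c := face V (n := 2) 3 x
  let x₂ := x - degen V (n := 2) 2 c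
  let b := face V (n := 2) 2 x₂
  let x₁ := x₂ - degen V (n := 2) 1 b
  let a := face V (n := 2) 1 x₁
  let x₀ := x₁ - degen V (n := 2) 0 a
  have e23 : face V (n := 2) 3 x₂ = 0 := by simp [x₂, c, face2_3_degen2]
  have e13 : face V (n := 2) 3 x₁ = 0 := by
    simp only [x₁, map_sub, e23, face2_3_degen1, b, ← face1_2_face2_3, map_zero, sub_zero]
  have e12 : face V (n := 2) 2 x₁ = 0 := by simp [x₁, b, face2_2_degen1]
  have e03 : face V (n := 2) 3 x₀ = 0 := by
    simp only [x₀, map_sub, e13, face2_3_degen0, a, ← face1_1_face2_3, map_zero, sub_zero]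
  have e02 : face V (n := 2) 2 x₀ = 0 := by
    simp only [x₀, map_sub, e12, face2_2_degen0, a, ← face1_1_face2_2, map_zero, sub_zero]
  have e01 : face V (n := 2) 1 x₀ = 0 := by simp [x₀, a, face2_1_degen0]
  have hx₀ : x₀ = 0 := by
    refine (Submodule.eq_bot_iff _).mp h3 x₀ (mem_normSub_succ.mpr fun i => ?_)
    fin_cases i
    exacts [e01, e02, e03]
  refine ⟨a, b, c, ?_⟩
  have : x = x₀ + (degen V (n := 2) 0 a + degen V (n := 2) 1 b + degen V (n := 2) 2 c) := by
    simp only [x₀, x₁, x₂]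
    abel
  rwa [hx₀, zero_add] at this

variable (V) in
/-- Both `ker f_0` and `ker f_1` are complements of the degenerate subspace of `V_1`. -/
def kerFaceEquiv : kerFace V ≃ₗ[ℝ] normSub V 1 :=
  LinearEquiv.ofLinearMap ((projOne V).comp (kerFace V).subtype)
    ((projKerFace V).comp (normSub V 1).subtype)
    (by
      ext u
      simp [projKerFace, coe_projOne, face0_1_degen0, mem_normSub_one.mp u.2])
    (by
      ext w
      simp [coe_projKerFace, coe_projOne, face0_0_degen0, LinearMap.mem_ker.mp w.2])

lemma coe_kerFaceEquiv (w : kerFace V) : (kerFaceEquiv V w : V _⦋1⦌) =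
    (w : V _⦋1⦌) - degen V (n := 0) 0 (face V (n := 0) 1 (w : V _⦋1⦌)) := rfl

/-- This accounts for the sign in `∂ = -f_1`: moving from the complement `ker f_0` to `ker f_1`
turns `-f_1` into the Moore differential `f_0`. -/
lemma face_zero_kerFaceEquiv (w : kerFace V) :
    face V (n := 0) 0 (kerFaceEquiv V w : V _⦋1⦌) = - face V (n := 0) 1 (w : V _⦋1⦌) := by
  rw [coe_kerFaceEquiv, map_sub, face0_0_degen0, LinearMap.mem_ker.mp w.2, zero_sub]

end Normalized

/-! ### Construction of cocycles -/

section Construction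

variable {V : SVect.{u}} (A : V _⦋0⦌ →ₗ[ℝ] V _⦋2⦌ →ₗ[ℝ] ℝ) (B : LinearMap.BilinForm ℝ (V _⦋1⦌))

/-- The cocycle with given pairings `A` and `B`. -/
def cocycleOf : LinearMap.BilinForm ℝ (V _⦋2⦌) :=
  A.comp ((face V (n := 0) 0).comp (face V (n := 1) 2))
    - (A.comp ((face V (n := 0) 0).comp (face V (n := 1) 1))).flip
    + B.compl₁₂ (face V (n := 1) 2) (face V (n := 1) 1)
    + (2⁻¹ : ℝ) • (B.compl₁₂ (face V (n := 1) 0) (face V (n := 1) 0)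
      - B.compl₁₂ (face V (n := 1) 1) (face V (n := 1) 1)
      - B.compl₁₂ (face V (n := 1) 2) (face V (n := 1) 2))

lemma cocycleOf_apply (x y : V _⦋2⦌) : cocycleOf A B x y =
    A (face V (n := 0) 0 (face V (n := 1) 2 x)) y - A (face V (n := 0) 0 (face V (n := 1) 1 y)) x
      + B (face V (n := 1) 2 x) (face V (n := 1) 1 y)
      + 2⁻¹ * (B (face V (n := 1) 0 x) (face V (n := 1) 0 y)
        - B (face V (n := 1) 1 x) (face V (n := 1) 1 y)
        - B (face V (n := 1) 2 x) (face V (n := 1) 2 y)) := by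
  simp [cocycleOf]

variable {A B} (hA₀ : ∀ v θ, A v (degen V (n := 1) 0 θ) = 0)
  (hA₁ : ∀ v θ, A v (degen V (n := 1) 1 θ) = 0)
  (hB : ∀ θ η, B θ η = B η θ) (hB₀ : ∀ c η, B (degen V (n := 0) 0 c) η = 0)
  (hAB : ∀ θ z, B θ (face V (n := 1) 0 z - face V (n := 1) 1 z + face V (n := 1) 2 z)
    = A (face V (n := 0) 0 θ - face V (n := 0) 1 θ) z)
include hB hAB in
-- With `d x = f_0 x - f_1 x + f_2 x`, the adjunction `hAB` makes the diagonal value `-½ B(d x, d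
-- x)`. Applied once more, it turns this into `A` evaluated on the differential of `d x`, which is
-- zero.
lemma isAlt_cocycleOf : (cocycleOf A B).IsAlt := by
  intro x
  have h0 := hAB (face V (n := 1) 0 x) x
  have h1 := hAB (face V (n := 1) 1 x) x
  have h2 := hAB (face V (n := 1) 2 x) x
  rw [cocycleOf_apply]
  simp only [map_sub, map_add, LinearMap.sub_apply, face_zero_face_one, face_zero_face_two,
    face_one_face_two] at h0 h1 h2 ⊢
  have s1 := hB (face V (n := 1) 1 x) (face V (n := 1) 0 x)
  have s2 := hB (face V (n := 1) 2 x) (face V (n := 1) 0 x)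
  have s3 := hB (face V (n := 1) 2 x) (face V (n := 1) 1 x)
  linarith

include hA₀ hA₁ hB hB₀ hAB in
-- Since `V_3` is spanned by degenerate elements, the coboundary need only be tested on pairs of
-- degeneracies. Equal indices follow from normalization, and alternation halves the mixed cases.
lemma isNormalizedCocycle_cocycleOf (h3 : normSub V 3 = ⊥) :
    IsNormalizedCocycle V (cocycleOf A B) := by
  have alt := isAlt_cocycleOf hB hAB
  have hB₀' : ∀ c η, B η (degen V (n := 0) 0 c) = 0 := fun c η => by rw [hB, hB₀]
  have n0 : ∀ θ η, cocycleOf A B (degen V (n := 1) 0 θ) (degen V (n := 1) 0 η) = 0 := fun θ η => by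
    simp only [cocycleOf_apply, hA₀, face1_0_degen0, face1_1_degen0, face1_2_degen0, hB₀]
    ring
  have n1 : ∀ θ η, cocycleOf A B (degen V (n := 1) 1 θ) (degen V (n := 1) 1 η) = 0 := fun θ η => by
    simp only [cocycleOf_apply, hA₁, face1_0_degen1, face1_1_degen1, face1_2_degen1, hB₀]
    ring
  have k0 : ∀ x θ, cocycleOf A B (degen V (n := 1) 0 θ) x = A (face V (n := 0) 1 θ) x
      + 2⁻¹ * (B θ (face V (n := 1) 0 x) - B θ (face V (n := 1) 1 x)) := fun x θ => by
    simp only [cocycleOf_apply, hA₀, face1_0_degen0, face1_1_degen0, face1_2_degen0, hB₀,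
      face0_0_degen0]
    ring
  have k1 : ∀ x θ, cocycleOf A B x (degen V (n := 1) 1 θ) = - A (face V (n := 0) 0 θ) x
      + 2⁻¹ * (B (face V (n := 1) 2 x) θ - B (face V (n := 1) 1 x) θ) := fun x θ => by
    simp only [cocycleOf_apply, hA₁, face1_0_degen1, face1_1_degen1, face1_2_degen1, hB₀']
    ring
  have k0' : ∀ x θ, cocycleOf A B x (degen V (n := 1) 0 θ) = - A (face V (n := 0) 1 θ) x
      - 2⁻¹ * (B θ (face V (n := 1) 0 x) - B θ (face V (n := 1) 1 x)) := fun x θ => by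
    rw [← alt.neg_eq, k0]
    ring
  have k1' : ∀ x θ, cocycleOf A B (degen V (n := 1) 1 θ) x = A (face V (n := 0) 0 θ) x
      - 2⁻¹ * (B (face V (n := 1) 2 x) θ - B (face V (n := 1) 1 x) θ) := fun x θ => by
    rw [← alt.neg_eq, k1]
    ring
  let D : LinearMap.BilinForm ℝ (V _⦋3⦌) := cobdry V (constForm (cocycleOf A B)) 0
  have hD : ∀ x y, D x y = _ := cobdry_constForm_two (cocycleOf A B) 0
  have D00 : ∀ x y, D (degen V (n := 2) 0 x) (degen V (n := 2) 0 y) = 0 := fun x y => by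
    simp only [hD, face2_0_degen0, face2_1_degen0, face2_2_degen0, face2_3_degen0, n0]
    ring
  have D11 : ∀ x y, D (degen V (n := 2) 1 x) (degen V (n := 2) 1 y) = 0 := fun x y => by
    simp only [hD, face2_0_degen1, face2_1_degen1, face2_2_degen1, face2_3_degen1, n0, n1]
    ring
  have D22 : ∀ x y, D (degen V (n := 2) 2 x) (degen V (n := 2) 2 y) = 0 := fun x y => by
    simp only [hD, face2_0_degen2, face2_1_degen2, face2_2_degen2, face2_3_degen2, n1]
    ring
  -- Of the mixed cases only this one invokes the adjunction directly, in two instances.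
  have D01 : ∀ x y, D (degen V (n := 2) 0 x) (degen V (n := 2) 1 y) = 0 := fun x y => by
    simp only [hD, face2_0_degen0, face2_1_degen0, face2_2_degen0, face2_3_degen0, face2_0_degen1,
      face2_1_degen1, face2_2_degen1, face2_3_degen1]
    have h1 := hAB (face V (n := 1) 0 y) x
    have h2 := hAB (face V (n := 1) 2 x) y
    rw [k0', k0, k0, cocycleOf_apply, hA₁, face1_0_degen1, face1_1_degen1, hB₀']
    simp only [map_sub, map_add, LinearMap.sub_apply, face_zero_face_one, face_zero_face_two,
      face_one_face_two] at h1 h2 ⊢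
    linarith [hB (face V (n := 1) 0 y) (face V (n := 1) 0 x),
      hB (face V (n := 1) 0 y) (face V (n := 1) 1 x),
      hB (face V (n := 1) 0 y) (face V (n := 1) 2 x)]
  have D02 : ∀ x y, D (degen V (n := 2) 0 x) (degen V (n := 2) 2 y) = 0 := fun x y => by
    simp only [hD, face2_0_degen0, face2_1_degen0, face2_2_degen0, face2_3_degen0, face2_0_degen2,
      face2_1_degen2, face2_2_degen2, face2_3_degen2]
    simp only [k1, k0, face_one_face_two, face_zero_face_one]
    ring
  have D12 : ∀ x y, D (degen V (n := 2) 1 x) (degen V (n := 2) 2 y) = 0 := fun x y => by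
    simp only [hD, face2_0_degen1, face2_1_degen1, face2_2_degen1, face2_3_degen1, face2_0_degen2,
      face2_1_degen2, face2_2_degen2, face2_3_degen2]
    rw [k0, k1, k1', cocycleOf_apply, hA₁, face1_0_degen1, face1_1_degen1, hB₀']
    simp only [face_zero_face_one, face_zero_face_two]
    linarith [hB (face V (n := 1) 2 y) (face V (n := 1) 2 x),
      hB (face V (n := 1) 1 y) (face V (n := 1) 2 x)]
  have Dalt : D.IsAlt := fun x => by simp [hD, alt _]
  refine ⟨alt, fun x y => (hD x y).symm.trans ?_, n0, n1⟩
  have D10 : ∀ x y, D (degen V (n := 2) 1 x) (degen V (n := 2) 0 y) = 0 := fun x y => by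
    rw [← Dalt.neg_eq, D01, neg_zero]
  have D20 : ∀ x y, D (degen V (n := 2) 2 x) (degen V (n := 2) 0 y) = 0 := fun x y => by
    rw [← Dalt.neg_eq, D02, neg_zero]
  have D21 : ∀ x y, D (degen V (n := 2) 2 x) (degen V (n := 2) 1 y) = 0 := fun x y => by
    rw [← Dalt.neg_eq, D12, neg_zero]
  obtain ⟨a, b, c, rfl⟩ := exists_eq_degen_add h3 x
  obtain ⟨a', b', c', rfl⟩ := exists_eq_degen_add h3 y
  simp only [map_add, LinearMap.add_apply, D00, D11, D22, D01, D02, D12, D10,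
    D20, D21, add_zero]

include hA₀ hB₀ in
lemma pairA_cocycleOf (x v : V _⦋0⦌) (w : V _⦋2⦌) :
    pairA V (constForm (cocycleOf A B)) x v w = A v w := by
  simp only [pairA_constForm, cocycleOf_apply, face1_0_degen0, face1_1_degen0, face1_2_degen0,
    face0_0_degen0, face0_1_degen0, hA₀, hB₀]
  ring

include hA₀ hA₁ hB hB₀ in
lemma pairB_cocycleOf (x : V _⦋0⦌) (θ η : V _⦋1⦌) :
    pairB V (constForm (cocycleOf A B)) x θ η = B θ η := by
  have hB₀' : ∀ c η, B η (degen V (n := 0) 0 c) = 0 := fun c η => by rw [hB, hB₀]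
  simp only [pairB_constForm, cocycleOf_apply, face1_0_degen0, face1_1_degen0, face1_2_degen0,
    face1_0_degen1, face1_1_degen1, face1_2_degen1, hA₀, hA₁, hB₀, hB₀', hB η θ]
  ring

end Construction

/-! ### The pairings of a constant symplectic 2-groupoid -/

section Pairings

variable {V : SVect.{u}}

/-- `A_ω` as a bilinear map. -/
def formA (ω : LinearMap.BilinForm ℝ (V _⦋2⦌)) : V _⦋0⦌ →ₗ[ℝ] V _⦋2⦌ →ₗ[ℝ] ℝ :=
  LinearMap.comp ω (unit2 V)

/-- `B_ω` as a bilinear form. -/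
def formB (ω : LinearMap.BilinForm ℝ (V _⦋2⦌)) : LinearMap.BilinForm ℝ (V _⦋1⦌) :=
  crossForm ω + LinearMap.flip (crossForm ω)

lemma pairA_eq_formA (ω : LinearMap.BilinForm ℝ (V _⦋2⦌)) (x v : V _⦋0⦌) (w : V _⦋2⦌) :
    pairA V (constForm ω) x v w = formA ω v w := rfl

lemma pairB_eq_formB (ω : LinearMap.BilinForm ℝ (V _⦋2⦌)) (x : V _⦋0⦌) (θ η : V _⦋1⦌) :
    pairB V (constForm ω) x θ η = formB ω θ η := rfl

lemma formB_comm (ω : LinearMap.BilinForm ℝ (V _⦋2⦌)) (θ η : V _⦋1⦌) :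
    formB ω θ η = formB ω η θ :=
  add_comm _ _

lemma eq_zero_of_formA {ω : LinearMap.BilinForm ℝ (V _⦋2⦌)}
    (hn : SimpliciallyNondegenerate V (constForm ω)) {z : normSub V 2}
    (hz : ∀ v, formA ω v z = 0) : z = 0 := by
  rw [← projTwo_coe z]
  exact projTwo_eq_zero (hn.right_A 0 z hz)

namespace IsNormalizedCocycle

variable {ω : LinearMap.BilinForm ℝ (V _⦋2⦌)} (h : IsNormalizedCocycle V ω)
include h

lemma formA_projTwo (v : V _⦋0⦌) (z : V _⦋2⦌) : formA ω v (projTwo V z) = formA ω v z := by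
  have := h.pairA_degenerate v (sub_projTwo_mem_degenerate z)
  rw [pairA_eq_formA, map_sub, sub_eq_zero] at this
  exact this.symm

lemma formB_degen (θ : V _⦋1⦌) (c : V _⦋0⦌) : formB ω θ (degen V (n := 0) 0 c) = 0 :=
  h.pairB_degen θ c

lemma degen_formB (θ : V _⦋1⦌) (c : V _⦋0⦌) : formB ω (degen V (n := 0) 0 c) θ = 0 := by
  rw [formB_comm, h.formB_degen]

lemma formB_projKerFace (θ η : V _⦋1⦌) :
    formB ω (projKerFace V θ) (projKerFace V η) = formB ω θ η := by
  simp only [coe_projKerFace, map_sub, LinearMap.sub_apply, h.formB_degen, h.degen_formB, sub_zero]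

lemma formB_kerFaceEquiv (w w' : kerFace V) :
    formB ω (kerFaceEquiv V w) (kerFaceEquiv V w') = formB ω (w : V _⦋1⦌) (w' : V _⦋1⦌) := by
  simp only [coe_kerFaceEquiv, map_sub, LinearMap.sub_apply, h.formB_degen, h.degen_formB, sub_zero]

/-- The differential `V_2 → V_1` on normalized elements is adjoint to `∂`. -/
lemma formB_face_zero (w : kerFace V) (z : normSub V 2) :
    formB ω (w : V _⦋1⦌) (face V (n := 1) 0 (z : V _⦋2⦌)) =
      formA ω (- face V (n := 0) 1 (w : V _⦋1⦌)) z := by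
  have := h.pairB_differential (w : V _⦋1⦌) z
  obtain ⟨h1, h2⟩ := mem_normSub_two.mp z.2
  rwa [h1, h2, sub_zero, add_zero, LinearMap.mem_ker.mp w.2, zero_sub] at this

lemma eq_zero_of_formB (hn : SimpliciallyNondegenerate V (constForm ω)) {w : kerFace V}
    (hw : ∀ w' : kerFace V, formB ω (w : V _⦋1⦌) (w' : V _⦋1⦌) = 0) : w = 0 := by
  have hB : ∀ η, formB ω (w : V _⦋1⦌) η = 0 := fun η => by
    rw [← h.formB_projKerFace, projKerFace_coe, hw]
  obtain ⟨c, hc⟩ := exists_eq_degen_of_mem_degenerate (hn.nondeg_B 0 w hB)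
  rw [← projKerFace_coe w, hc, projKerFace_degen]

end IsNormalizedCocycle

end Pairings

namespace ConstSympGpd

variable (G : ConstSympGpd.{u})

lemma isNormalizedCocycle : IsNormalizedCocycle G.V G.ω := G.isSymplectic.isNormalizedCocycle

instance finiteDimensional (n : ℕ) : FiniteDimensional ℝ (G.V _⦋n⦌) := G.isLinear.finite n

/-- The isomorphism of the normalized part of `V_2` with the dual of `V_0` defined by `A_ω`. -/
def dualEquiv : normSub G.V 2 ≃ₗ[ℝ] Module.Dual ℝ (G.V _⦋0⦌) :=
  LinearEquiv.ofBijective ((formA G.ω).flip.comp (normSub G.V 2).subtype) <| by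
    have hinj : Function.Injective ((formA G.ω).flip.comp (normSub G.V 2).subtype) :=
      (injective_iff_map_eq_zero _).mpr fun z hz =>
        eq_zero_of_formA G.isSymplectic.nondeg fun v =>
          LinearMap.congr_fun hz v
    have hinj' : Function.Injective ((formA G.ω).compl₂ (normSub G.V 2).subtype) :=
      (injective_iff_map_eq_zero _).mpr fun v hv =>
        G.isSymplectic.nondeg.left_A 0 v fun w => by
          rw [pairA_eq_formA, ← G.isNormalizedCocycle.formA_projTwo]
          exact LinearMap.congr_fun hv (projTwo G.V w)
    -- Nondegeneracy on both sides bounds each dimension by the other, so the injection is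
    -- bijective.
    have h1 : Module.finrank ℝ (normSub G.V 2) ≤ Module.finrank ℝ (Module.Dual ℝ (G.V _⦋0⦌)) :=
      LinearMap.finrank_le_finrank_of_injective hinj
    have h2 : Module.finrank ℝ (G.V _⦋0⦌) ≤ Module.finrank ℝ (Module.Dual ℝ (normSub G.V 2)) :=
      LinearMap.finrank_le_finrank_of_injective hinj'
    have h3 := Subspace.dual_finrank_eq (K := ℝ) (V := G.V _⦋0⦌)
    have h4 := Subspace.dual_finrank_eq (K := ℝ) (V := normSub G.V 2)
    exact ⟨hinj, (LinearMap.injective_iff_surjective_of_finrank_eq_finrank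
      (h1.antisymm (by rw [h3]; omega))).mp hinj⟩

lemma dualEquiv_apply (z : normSub G.V 2) (v : G.V _⦋0⦌) : G.dualEquiv z v = formA G.ω v z := rfl

/-- The symmetric form `B_ω` on `W₁`. -/
def pairing : LinearMap.BilinForm ℝ (kerFace G.V) := (formB G.ω).restrict (kerFace G.V)

lemma pairing_apply (w w' : kerFace G.V) :
    G.pairing w w' = formB G.ω (w : G.V _⦋1⦌) (w' : G.V _⦋1⦌) := rfl

lemma pairing_isSymm : G.pairing.IsSymm := ⟨fun w w' => formB_comm G.ω w w'⟩

lemma pairing_nondegenerate : G.pairing.Nondegenerate := by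
  have h : G.pairing.SeparatingLeft := fun w hw =>
    G.isNormalizedCocycle.eq_zero_of_formB G.isSymplectic.nondeg hw
  exact ⟨h, fun w hw => h w fun w' => by rw [pairing_apply, formB_comm]; exact hw w'⟩

/-- `∂ w = - f_1 w`. -/
def bd : kerFace G.V →ₗ[ℝ] G.V _⦋0⦌ := - (face G.V (n := 0) 1).comp (kerFace G.V).subtype

lemma bd_apply (w : kerFace G.V) : G.bd w = - face G.V (n := 0) 1 (w : G.V _⦋1⦌) := rfl

end ConstSympGpd

lemma pairing_transposeVia {W₁ W₀ : Type*} [AddCommGroup W₁] [Module ℝ W₁]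
    [FiniteDimensional ℝ W₁] [AddCommGroup W₀] [Module ℝ W₀] (b : LinearMap.BilinForm ℝ W₁)
    (hb : b.Nondegenerate) (bd : W₁ →ₗ[ℝ] W₀) (ξ : Module.Dual ℝ W₀) (w : W₁) :
    b (transposeVia b hb bd ξ) w = ξ (bd w) :=
  LinearMap.BilinForm.apply_toDual_symm_apply (hB := hb) _ _

/-- The tuple of a constant symplectic 2-groupoid. -/
def ConstSympGpd.data (G : ConstSympGpd.{u}) : LinData.{u} where
  W₁ := kerFace G.V
  W₀ := G.V _⦋0⦌
  pairing := G.pairing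
  symm := G.pairing_isSymm
  nondeg := G.pairing_nondegenerate
  bd := G.bd
  isotropic := by
    rintro _ ⟨ξ, rfl⟩ _ ⟨ξ', rfl⟩
    obtain ⟨z, rfl⟩ := G.dualEquiv.surjective ξ'
    have hz := mem_normSub_two.mp z.2
    -- Under the identification by `A`, the transpose of `∂` is the differential `f_0` in degree 2.
    -- Isotropy is then the vanishing of two successive differentials.
    have key : transposeVia G.pairing G.pairing_nondegenerate G.bd (G.dualEquiv z) =
        projKerFace G.V (face G.V (n := 1) 0 (z : G.V _⦋2⦌)) := by
      refine (G.pairing.toDual G.pairing_nondegenerate).injective (LinearMap.ext fun w => ?_)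
      rw [LinearMap.BilinForm.toDual_def, LinearMap.BilinForm.toDual_def, pairing_transposeVia,
        G.dualEquiv_apply, G.bd_apply, ← G.isNormalizedCocycle.formB_face_zero, G.pairing_apply,
        formB_comm, ← G.isNormalizedCocycle.formB_projKerFace, projKerFace_coe]
    have hbd : G.bd (projKerFace G.V (face G.V (n := 1) 0 (z : G.V _⦋2⦌))) = 0 := by
      rw [G.bd_apply, coe_projKerFace, map_sub, face0_1_degen0, ← face_zero_face_two,
        ← face_zero_face_one, hz.1, hz.2]
      simp
    rw [pairing_transposeVia, key, hbd, map_zero]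

lemma hasData_data (G : ConstSympGpd.{u}) : HasData G G.data :=
  ⟨LinearEquiv.refl _ _, LinearEquiv.refl _ _, fun _ _ => rfl, fun _ => rfl⟩

lemma HasData.isomorphic {G : ConstSympGpd.{u}} {T T' : LinData.{u}} (h : HasData G T)
    (h' : HasData G T') : T.Isomorphic T' := by
  obtain ⟨e₁, e₀, h1, h2⟩ := h
  obtain ⟨e₁', e₀', h1', h2'⟩ := h'
  refine ⟨e₁.trans e₁'.symm, e₀.trans e₀'.symm, fun w w' => ?_, fun w => ?_⟩
  · rw [h1', h1]; simp
  · apply e₀'.injective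
    rw [h2']
    simp [h2]

lemma HasData.of_isomorphic {G : ConstSympGpd.{u}} {T T' : LinData.{u}} (h : HasData G T)
    (h' : T'.Isomorphic T) : HasData G T' := by
  obtain ⟨e₁, e₀, h1, h2⟩ := h
  obtain ⟨g₁, g₀, h1', h2'⟩ := h'
  refine ⟨g₁.trans e₁, g₀.trans e₀, fun w w' => ?_, fun w => ?_⟩
  · rw [← h1', h1]; rfl
  · simp only [LinearEquiv.trans_apply, ← h2', h2]

/-- The components of an isomorphism of simplicial vector spaces. -/
def levelEquiv {V V' : SVect.{u}} (φ : V ≅ V') (n : ℕ) : V _⦋n⦌ ≃ₗ[ℝ] V' _⦋n⦌ :=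
  LinearEquiv.ofLinearMap (level φ.hom n) (level φ.inv n)
    (by ext x; simp [← level_comp, level_id]) (by ext x; simp [← level_comp, level_id])

lemma levelEquiv_apply {V V' : SVect.{u}} (φ : V ≅ V') (n : ℕ) (x : V _⦋n⦌) :
    levelEquiv φ n x = level φ.hom n x := rfl

lemma HasData.of_equivalent {G G' : ConstSympGpd.{u}} {T : LinData.{u}} (h : HasData G T)
    (h' : G.Equivalent G') : HasData G' T := by
  obtain ⟨e₁, e₀, h1, h2⟩ := h
  obtain ⟨φ, hφ⟩ := h'
  have hmap : (kerFace G.V).map (levelEquiv φ 1).toLinearMap = kerFace G'.V := by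
    ext x
    rw [Submodule.mem_map_equiv, LinearMap.mem_ker, LinearMap.mem_ker,
      ← (levelEquiv φ 0).map_eq_zero_iff, levelEquiv_apply, ← level_face, ← levelEquiv_apply,
      LinearEquiv.apply_symm_apply]
  refine ⟨e₁.trans (((levelEquiv φ 1).submoduleMap _).trans (LinearEquiv.ofEq _ _ hmap)),
    e₀.trans (levelEquiv φ 0), fun w w' => ?_, fun w => ?_⟩
  · rw [h1, ← hφ.pairB_eq]
    simp only [pairB, ConstSymp.pullback, LinearMap.BilinForm.comp_apply, ← level_degen]
    rfl
  · rw [LinearEquiv.trans_apply, h2, map_neg, levelEquiv_apply, ← level_face]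
    rfl

/-! ### Classification -/

/-- A family of equivalences of normalized subspaces, given in degrees at most two. -/
def normSubEquivOf {V V' : SVect.{u}} (e₀ : V _⦋0⦌ ≃ₗ[ℝ] V' _⦋0⦌)
    (e₁ : normSub V 1 ≃ₗ[ℝ] normSub V' 1) (e₂ : normSub V 2 ≃ₗ[ℝ] normSub V' 2)
    (h : ∀ n, normSub V (n + 3) = ⊥) (h' : ∀ n, normSub V' (n + 3) = ⊥) (n : ℕ) :
    normSub V n ≃ₗ[ℝ] normSub V' n :=
  match n with
  | 0 => (Submodule.topEquiv (R := ℝ) (M := V _⦋0⦌)).trans (e₀.trans Submodule.topEquiv.symm)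
  | 1 => e₁
  | 2 => e₂
  | n + 3 => (LinearEquiv.ofEq _ _ (h n)).trans
      ((0 : (⊥ : Submodule ℝ (V _⦋n + 3⦌)) ≃ₗ[ℝ] (⊥ : Submodule ℝ (V' _⦋n + 3⦌))).trans
        (LinearEquiv.ofEq _ _ (h' n).symm))

namespace ConstSympGpd

/-- In degree 2 the isomorphism is forced to be the inverse transpose of `g₀` under the two
identifications by `A`. Adjointness makes it a chain map, and Dold–Kan extends it. -/
lemma equivalent_of_data {G G' : ConstSympGpd.{u}} (g₁ : kerFace G.V ≃ₗ[ℝ] kerFace G'.V)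
    (g₀ : G.V _⦋0⦌ ≃ₗ[ℝ] G'.V _⦋0⦌)
    (hp : ∀ w w', G'.pairing (g₁ w) (g₁ w') = G.pairing w w')
    (hb : ∀ w, G'.bd (g₁ w) = g₀ (G.bd w)) : G.Equivalent G' := by
  have hω := G.isNormalizedCocycle
  have hω' := G'.isNormalizedCocycle
  let e₁ : normSub G.V 1 ≃ₗ[ℝ] normSub G'.V 1 :=
    (kerFaceEquiv G.V).symm.trans (g₁.trans (kerFaceEquiv G'.V))
  have he₁ : ∀ w, e₁ (kerFaceEquiv G.V w) = kerFaceEquiv G'.V (g₁ w) := fun w => by simp [e₁]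
  let e₂ : normSub G.V 2 ≃ₗ[ℝ] normSub G'.V 2 :=
    G.dualEquiv.trans (g₀.symm.dualMap.trans G'.dualEquiv.symm)
  have he₂ : ∀ v z, formA G'.ω (g₀ v) (e₂ z) = formA G.ω v z := fun v z => by
    rw [← G'.dualEquiv_apply, ← G.dualEquiv_apply]
    simp [e₂]
  have c₀ : ∀ u : normSub G.V 1, g₀ (face G.V (n := 0) 0 (u : G.V _⦋1⦌)) =
      face G'.V (n := 0) 0 (e₁ u : G'.V _⦋1⦌) := fun u => by
    obtain ⟨w, rfl⟩ := (kerFaceEquiv G.V).surjective u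
    rw [he₁, face_zero_kerFaceEquiv, face_zero_kerFaceEquiv]
    exact (hb w).symm
  have c₁ : ∀ z : normSub G.V 2,
      (e₁ ⟨face G.V (n := 1) 0 (z : G.V _⦋2⦌), face_zero_mem_normSub z.2⟩ : G'.V _⦋1⦌) =
        face G'.V (n := 1) 0 (e₂ z : G'.V _⦋2⦌) := fun z => by
    obtain ⟨a, ha⟩ := (kerFaceEquiv G.V).surjective
      ⟨face G.V (n := 1) 0 (z : G.V _⦋2⦌), face_zero_mem_normSub z.2⟩
    obtain ⟨b, hb'⟩ := (kerFaceEquiv G'.V).surjective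
      ⟨face G'.V (n := 1) 0 (e₂ z : G'.V _⦋2⦌), face_zero_mem_normSub (e₂ z).2⟩
    rw [← ha, he₁]
    refine Eq.trans ?_ (congrArg Subtype.val hb')
    refine congrArg (fun w => (kerFaceEquiv G'.V w : G'.V _⦋1⦌)) ?_
    -- Equality is tested against `B`. On both sides `formB_face_zero` replaces the differential of
    -- degree 2 by `A` and `∂`, which `he₂` and `hb` match.
    refine sub_eq_zero.mp (hω'.eq_zero_of_formB G'.isSymplectic.nondeg fun w' => ?_)
    obtain ⟨w, rfl⟩ := g₁.surjective w'
    have ka : (kerFaceEquiv G.V a : G.V _⦋1⦌) = face G.V (n := 1) 0 (z : G.V _⦋2⦌) :=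
      congrArg Subtype.val ha
    have kb : (kerFaceEquiv G'.V b : G'.V _⦋1⦌) = face G'.V (n := 1) 0 (e₂ z : G'.V _⦋2⦌) :=
      congrArg Subtype.val hb'
    have kw : g₀ (- face G.V (n := 0) 1 (w : G.V _⦋1⦌)) =
        - face G'.V (n := 0) 1 (g₁ w : G'.V _⦋1⦌) := (hb w).symm
    have h1 : formB G'.ω (g₁ a : G'.V _⦋1⦌) (g₁ w : G'.V _⦋1⦌) =
        formB G.ω (a : G.V _⦋1⦌) (w : G.V _⦋1⦌) := hp a w
    have h2 : formB G.ω (w : G.V _⦋1⦌) (a : G.V _⦋1⦌) =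
        formB G.ω (w : G.V _⦋1⦌) (kerFaceEquiv G.V a : G.V _⦋1⦌) := by
      rw [coe_kerFaceEquiv, map_sub, hω.formB_degen, sub_zero]
    have h3 : formB G'.ω (g₁ w : G'.V _⦋1⦌) (b : G'.V _⦋1⦌) =
        formB G'.ω (g₁ w : G'.V _⦋1⦌) (kerFaceEquiv G'.V b : G'.V _⦋1⦌) := by
      rw [coe_kerFaceEquiv, map_sub, hω'.formB_degen, sub_zero]
    rw [Submodule.coe_sub, map_sub, LinearMap.sub_apply, sub_eq_zero, h1, formB_comm, h2, ka,
      hω.formB_face_zero, formB_comm, h3, kb, hω'.formB_face_zero, ← kw, he₂]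
  obtain ⟨φ, hφ⟩ := exists_iso_of_normSub_equiv
    (normSubEquivOf g₀ e₁ e₂ G.isLinear.normSub_eq_bot G'.isLinear.normSub_eq_bot) (by
      intro n x
      match n with
      | 0 => exact c₀ x
      | 1 => exact c₁ x
      | 2 =>
        have hx : x = 0 := Subtype.ext ((Submodule.eq_bot_iff _).mp
          (G.isLinear.normSub_eq_bot 0) x x.2)
        subst hx
        simp [normSubEquivOf]
      | n + 3 =>
        have hx : x = 0 := Subtype.ext ((Submodule.eq_bot_iff _).mp
          (G.isLinear.normSub_eq_bot (n + 1)) x x.2)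
        subst hx
        simp [normSubEquivOf])
  have φ₀ : ∀ v, level φ.hom 0 v = g₀ v := fun v => hφ 0 ⟨v, trivial⟩
  have φ₁ : ∀ u : normSub G.V 1, level φ.hom 1 u = e₁ u := hφ 1
  have φ₂ : ∀ u : normSub G.V 2, level φ.hom 2 u = e₂ u := hφ 2
  have hpb := hω'.pullback φ.hom
  -- The isomorphism need not carry one form to the other exactly; agreement of `A` and `B`
  -- suffices, and it can be checked on normalized representatives.
  refine ⟨φ, hω.formEquiv hpb (fun v z => ?_) fun θ η => ?_⟩
  · rw [pairA_eq_formA, pairA_eq_formA, ← hpb.formA_projTwo, ← hω.formA_projTwo, ← he₂, ← φ₂,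
      ← φ₀]
    simp only [formA, LinearMap.comp_apply, level_unit2]
    rfl
  · rw [pairB_eq_formB, pairB_eq_formB, ← hpb.formB_projKerFace, ← hω.formB_projKerFace]
    have key : ∀ w w' : kerFace G.V, formB (G'.ω.comp (level φ.hom 2) (level φ.hom 2))
        (w : G.V _⦋1⦌) (w' : G.V _⦋1⦌) = formB G.ω (w : G.V _⦋1⦌) (w' : G.V _⦋1⦌) := fun w w' => by
      rw [← hpb.formB_kerFaceEquiv, ← pairing_apply, ← hp, pairing_apply, ← hω'.formB_kerFaceEquiv,
        ← he₁, ← he₁, ← φ₁, ← φ₁, ← pairB_eq_formB _ 0, ← pairB_eq_formB _ 0]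
      simp only [pairB_constForm, level_degen]
      rfl
    exact key _ _

end ConstSympGpd

lemma HasData.equivalent {G G' : ConstSympGpd.{u}} {T : LinData.{u}} (h : HasData G T)
    (h' : HasData G' T) : G.Equivalent G' := by
  obtain ⟨e₁, e₀, h1, h2⟩ := h
  obtain ⟨e₁', e₀', h1', h2'⟩ := h'
  refine ConstSympGpd.equivalent_of_data (e₁.symm.trans e₁') (e₀.symm.trans e₀')
    (fun w w' => ?_) fun w => ?_
  · have a := h1 (e₁.symm w) (e₁.symm w')
    have b := h1' (e₁.symm w) (e₁.symm w')
    rw [LinearEquiv.apply_symm_apply, LinearEquiv.apply_symm_apply] at a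
    exact b.symm.trans a
  · have a := h2 (e₁.symm w)
    have b := h2' (e₁.symm w)
    rw [LinearEquiv.apply_symm_apply] at a
    refine b.symm.trans ?_
    rw [LinearEquiv.trans_apply, G.bd_apply, ← a, LinearEquiv.symm_apply_apply]

/-! ### Realization of linear data -/

namespace LinData

variable (T : LinData.{u})

/-- `∂^*`. -/
def bdStar : Module.Dual ℝ T.W₀ →ₗ[ℝ] T.W₁ := transposeVia T.pairing T.nondeg T.bd

/-- Pairing `∂∂^*ξ` with a covector `ξ'` gives `⟨∂^*ξ', ∂^*ξ⟩`, so isotropy is exactly the complex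
condition. -/
lemma bd_bdStar (ξ : Module.Dual ℝ T.W₀) : T.bd (T.bdStar ξ) = 0 := by
  rw [← Module.forall_dual_apply_eq_zero_iff ℝ]
  intro ξ'
  rw [← pairing_transposeVia T.pairing T.nondeg]
  exact T.isotropic _ ⟨ξ', rfl⟩ _ ⟨ξ, rfl⟩

/-- The terms of the complex `W₀^* → W₁ → W₀`. -/
def complexX (n : ℕ) : ModuleCat.{u} ℝ :=
  match n with
  | 0 => ModuleCat.of ℝ T.W₀
  | 1 => ModuleCat.of ℝ T.W₁
  | 2 => ModuleCat.of ℝ (Module.Dual ℝ T.W₀)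
  | _ + 3 => ModuleCat.of ℝ PUnit.{u + 1}

/-- The differentials of the complex `W₀^* → W₁ → W₀`. -/
def complexD (n : ℕ) : T.complexX (n + 1) ⟶ T.complexX n :=
  match n with
  | 0 => ModuleCat.ofHom T.bd
  | 1 => ModuleCat.ofHom T.bdStar
  | _ + 2 => 0

/-- The complex `W₀^* → W₁ → W₀`. -/
def complex : ChainComplex (ModuleCat.{u} ℝ) ℕ :=
  ChainComplex.of T.complexX T.complexD fun n => by
    match n with
    | 0 => exact ModuleCat.hom_ext (LinearMap.ext T.bd_bdStar)
    | _ + 1 => exact Limits.zero_comp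

/-- A linear 2-groupoid with normalized complex `W₀^* → W₁ → W₀`. -/
lemma exists_linearTwoGroupoid :
    ∃ (V : SVect.{u}) (_ : IsLinearTwoGroupoid V) (i₀ : T.W₀ ≃ₗ[ℝ] V _⦋0⦌)
      (i₁ : T.W₁ ≃ₗ[ℝ] normSub V 1) (i₂ : Module.Dual ℝ T.W₀ ≃ₗ[ℝ] normSub V 2),
      (∀ w, face V (n := 0) 0 (i₁ w : V _⦋1⦌) = i₀ (T.bd w)) ∧
      (∀ ξ, face V (n := 1) 0 (i₂ ξ : V _⦋2⦌) = i₁ (T.bdStar ξ)) := by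
  obtain ⟨V, e, he⟩ := exists_normSub_equiv T.complex
  have hd : ∀ n, T.complex.d (n + 1) n = T.complexD n := fun n => ChainComplex.of_d _ _ _
  have hfin : ∀ n, FiniteDimensional ℝ (T.complexX n) := fun n =>
    match n with
    | 0 => T.finite₀
    | 1 => T.finite₁
    | 2 => inferInstanceAs (FiniteDimensional ℝ (Module.Dual ℝ T.W₀))
    | _ + 3 => inferInstanceAs (FiniteDimensional ℝ PUnit)
  have h3 : ∀ n, normSub V (n + 3) = ⊥ := fun n => by
    refine (Submodule.eq_bot_iff _).mpr fun x hx => ?_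
    have : Subsingleton (T.complex.X (n + 3)) := inferInstanceAs (Subsingleton PUnit)
    have : Subsingleton (normSub V (n + 3)) := (e (n + 3)).symm.toEquiv.subsingleton
    exact congrArg Subtype.val (Subsingleton.elim (⟨x, hx⟩ : normSub V (n + 3)) 0)
  refine ⟨V, isLinearTwoGroupoid_of_normSub (fun n => ?_) h3,
    (e 0).trans (Submodule.topEquiv (R := ℝ) (M := V _⦋0⦌)), e 1, e 2, fun w => ?_, fun ξ => ?_⟩
  · have : FiniteDimensional ℝ (T.complex.X n) := hfin n
    exact Module.Finite.equiv (e n)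
  · refine (he 0 w).trans ?_
    rw [hd]
    rfl
  · refine (he 1 ξ).trans ?_
    rw [hd]
    rfl

end LinData

lemma face_zero_projOne {V : SVect.{u}} (θ : V _⦋1⦌) :
    face V (n := 0) 0 (projOne V θ : V _⦋1⦌) = face V (n := 0) 0 θ - face V (n := 0) 1 θ := by
  rw [coe_projOne, map_sub, face0_0_degen0]

/-- Modulo degenerate elements the alternating sum of faces is the Moore differential. This
translates the adjunction required of `cocycleOf` into a statement about the normalized complex. -/
lemma projOne_differential {V : SVect.{u}} (z : V _⦋2⦌) :
    (projOne V (face V (n := 1) 0 z - face V (n := 1) 1 z + face V (n := 1) 2 z) : V _⦋1⦌) =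
      face V (n := 1) 0 (projTwo V z : V _⦋2⦌) := by
  rw [coe_projOne, coe_projTwo]
  simp only [map_sub, map_add, face1_0_degen0, face1_0_degen1, face1_1_degen1,
    face_zero_face_two, face_one_face_two]
  abel

theorem exists_hasData (T : LinData.{u}) : ∃ G : ConstSympGpd.{u}, HasData G T := by
  obtain ⟨V, hV, i₀, i₁, i₂, h₁, h₂⟩ := T.exists_linearTwoGroupoid
  let p₁ : V _⦋1⦌ →ₗ[ℝ] T.W₁ := i₁.symm.toLinearMap.comp (projOne V)
  let p₂ : V _⦋2⦌ →ₗ[ℝ] Module.Dual ℝ T.W₀ := i₂.symm.toLinearMap.comp (projTwo V)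
  -- `A` is the evaluation pairing of `W₀^*` with `W₀`, extended by zero on degenerate elements; `B`
  -- likewise extends the given form on `W₁`. The adjunction `hAB` is then the defining property of
  -- `∂^*`.
  let A : V _⦋0⦌ →ₗ[ℝ] V _⦋2⦌ →ₗ[ℝ] ℝ := LinearMap.flip (i₀.symm.toLinearMap.dualMap.comp p₂)
  let B : LinearMap.BilinForm ℝ (V _⦋1⦌) := T.pairing.compl₁₂ p₁ p₁
  have hA : ∀ v z, A v z = p₂ z (i₀.symm v) := fun _ _ => rfl
  have hB : ∀ θ η, B θ η = T.pairing (p₁ θ) (p₁ η) := fun _ _ => rfl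
  have hp₁ : ∀ w, p₁ (i₁ w : V _⦋1⦌) = w := fun w => by simp [p₁, projOne_coe]
  have hp₂ : ∀ ξ, p₂ (i₂ ξ : V _⦋2⦌) = ξ := fun ξ => by simp [p₂, projTwo_coe]
  have hA₀ : ∀ v θ, A v (degen V (n := 1) 0 θ) = 0 := fun v θ => by
    simp [hA, p₂, projTwo_degen_zero]
  have hA₁ : ∀ v θ, A v (degen V (n := 1) 1 θ) = 0 := fun v θ => by
    simp [hA, p₂, projTwo_degen_one]
  have hBs : ∀ θ η, B θ η = B η θ := fun θ η => T.symm.eq _ _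
  have hB₀ : ∀ c η, B (degen V (n := 0) 0 c) η = 0 := fun c η => by
    simp [hB, p₁, projOne_degen]
  have hAB : ∀ θ z, B θ (face V (n := 1) 0 z - face V (n := 1) 1 z + face V (n := 1) 2 z)
      = A (face V (n := 0) 0 θ - face V (n := 0) 1 θ) z := fun θ z => by
    obtain ⟨w, hw⟩ := i₁.surjective (projOne V θ)
    obtain ⟨ξ, hξ⟩ := i₂.surjective (projTwo V z)
    have e1 : p₁ θ = w := by simp [p₁, ← hw]
    have e2 : p₂ z = ξ := by simp [p₂, ← hξ]
    have e3 : p₁ (face V (n := 1) 0 z - face V (n := 1) 1 z + face V (n := 1) 2 z)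
        = T.bdStar ξ := by
      have : projOne V (face V (n := 1) 0 z - face V (n := 1) 1 z + face V (n := 1) 2 z)
          = i₁ (T.bdStar ξ) := Subtype.ext (by rw [projOne_differential, ← hξ, h₂])
      simp [p₁, this]
    rw [hBs, hB, hA, e1, e2, e3, ← face_zero_projOne, ← hw, h₁, LinearEquiv.symm_apply_apply]
    exact pairing_transposeVia _ _ _ _ _
  have hω := isNormalizedCocycle_cocycleOf hA₀ hA₁ hBs hB₀ hAB (hV.normSub_eq_bot 0)
  have hωA := pairA_cocycleOf hA₀ hB₀
  have hωB := pairB_cocycleOf hA₀ hA₁ hBs hB₀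
  have hbd : ∀ w, i₀ (T.bd w) = - face V (n := 0) 1 ((kerFaceEquiv V).symm (i₁ w) : V _⦋1⦌) :=
    fun w => by
      have := face_zero_kerFaceEquiv ((kerFaceEquiv V).symm (i₁ w))
      rw [LinearEquiv.apply_symm_apply] at this
      exact (h₁ w).symm.trans this
  refine ⟨⟨V, hV, cocycleOf A B, hω.isSymplecticForm ⟨fun x v hv => ?_, fun x z hz => ?_,
    fun x θ hθ => ?_⟩⟩, i₁.trans (kerFaceEquiv V).symm, i₀, fun w w' => ?_, fun w => ?_⟩
  · rw [← i₀.symm.map_eq_zero_iff, ← Module.forall_dual_apply_eq_zero_iff ℝ]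
    intro ξ
    have := hv (i₂ ξ : V _⦋2⦌)
    rwa [hωA, hA, hp₂] at this
  · have h0 : projTwo V z = 0 := by
      rw [← i₂.symm.map_eq_zero_iff]
      ext w
      have := hz (i₀ w)
      rwa [hωA, hA, LinearEquiv.symm_apply_apply] at this
    have := sub_projTwo_mem_degenerate z
    rwa [h0, ZeroMemClass.coe_zero, sub_zero] at this
  · have h0 : projOne V θ = 0 := by
      rw [← i₁.symm.map_eq_zero_iff]
      refine T.nondeg.1 _ fun w => ?_
      have := hθ (i₁ w : V _⦋1⦌)
      rwa [hωB, hB, hp₁] at this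
    have h1 := congrArg Subtype.val h0
    rw [coe_projOne, ZeroMemClass.coe_zero, sub_eq_zero] at h1
    rw [h1]
    exact degen_mem_degenerate 0 _
  · have hk : ∀ w, p₁ ((kerFaceEquiv V).symm (i₁ w) : V _⦋1⦌) = w := fun w => by
      have : projOne V ((kerFaceEquiv V).symm (i₁ w) : V _⦋1⦌) = i₁ w :=
        (kerFaceEquiv V).apply_symm_apply (i₁ w)
      simp [p₁, this]
    refine Eq.trans ?_ (hωB 0 _ _).symm
    rw [hB]
    exact (congrArg₂ (fun a b => T.pairing a b) (hk w) (hk w')).symm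
  · exact hbd w

/-- The bijection between equivalence classes of constant symplectic 2-groupoids and isomorphism
classes of linear data. -/
theorem exists_classEquiv :
    ∃ F : Quotient ConstSympGpd.setoid.{u} ≃ Quotient LinData.setoid.{u},
      ∀ (G : ConstSympGpd.{u}) (T : LinData.{u}),
        F (Quotient.mk _ G) = Quotient.mk _ T ↔ HasData G T := by
  let f : Quotient ConstSympGpd.setoid.{u} → Quotient LinData.setoid.{u} :=
    Quotient.lift (fun G => Quotient.mk _ G.data) fun G G' h =>
      Quotient.sound ((hasData_data G).of_equivalent h |>.isomorphic (hasData_data G'))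
  have hf : ∀ (G : ConstSympGpd.{u}) (T : LinData.{u}),
      f (Quotient.mk _ G) = Quotient.mk _ T ↔ HasData G T := fun G T =>
    ⟨fun h => (hasData_data G).of_isomorphic (LinData.setoid.symm (Quotient.exact h)),
      fun h => Quotient.sound ((hasData_data G).isomorphic h)⟩
  refine ⟨Equiv.ofBijective f ⟨?_, ?_⟩, hf⟩
  · rintro ⟨G⟩ ⟨G'⟩ h
    exact Quotient.sound (((hf G G'.data).mp h).equivalent (hasData_data G'))
  · rintro ⟨T⟩
    obtain ⟨G, hG⟩ := exists_hasData T
    exact ⟨Quotient.mk _ G, (hf G T).mpr hG⟩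

end ConstSymp

end

theorem theorem3p6 :
    -- The assignment of its tuple to a constant symplectic 2-groupoid is a bijection on classes.
    (∃ F : Quotient ConstSymp.ConstSympGpd.setoid.{u} ≃ Quotient ConstSymp.LinData.setoid.{u},
      ∀ (G : ConstSymp.ConstSympGpd.{u}) (T : ConstSymp.LinData.{u}),
        F (Quotient.mk _ G) = Quotient.mk _ T ↔ ConstSymp.HasData G T) ∧
    -- On a fixed linear 2-groupoid, equivalences fix all data but `r` and act transitively on `r`.
    (∀ G : ConstSymp.ConstSympGpd.{u},
      (∀ ω' : LinearMap.BilinForm ℝ (G.V _⦋2⦌),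
        ConstSymp.IsSymplecticForm G.V (ConstSymp.constForm ω') →
        (ConstSymp.FormEquiv G.V (ConstSymp.constForm G.ω) (ConstSymp.constForm ω') ↔
          (∀ v w, ConstSymp.pairA G.V (ConstSymp.constForm ω') 0 v w =
            ConstSymp.pairA G.V (ConstSymp.constForm G.ω) 0 v w) ∧
          (∀ θ η, ConstSymp.pairB G.V (ConstSymp.constForm ω') 0 θ η =
            ConstSymp.pairB G.V (ConstSymp.constForm G.ω) 0 θ η))) ∧
      (∀ r : LinearMap.BilinForm ℝ (ConstSymp.kerFace G.V), r.IsAlt →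
        ∃! ω' : LinearMap.BilinForm ℝ (G.V _⦋2⦌),
          ConstSymp.IsSymplecticForm G.V (ConstSymp.constForm ω') ∧
          ConstSymp.FormEquiv G.V (ConstSymp.constForm G.ω) (ConstSymp.constForm ω') ∧
          ∀ w w', ConstSymp.skewPart G.V ω' w w' = r w w')) := by
  refine ⟨ConstSymp.exists_classEquiv, fun G => ⟨fun ω' h' => ?_, fun r hr => ?_⟩⟩
  · exact ConstSymp.formEquiv_iff G.isNormalizedCocycle h'.isNormalizedCocycle
  · exact ConstSymp.existsUnique_skewPart G.isSymplectic hr
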